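/- **Conventions.** A variety over a field $k$ is an integral separated scheme of finite type over $k$. The exceptional locus of a birational map $f\colon A\dashrightarrow B$ of varieties over $k$ is the closed set of points of $A$ having no open neighbourhood on which $f$ is an isomorphism onto an open subset of $B$. The map $f$ is an isomorphism in codimension $\ell$ if the exceptional loci of $f$ and $f^{-1}$ have codimension $>\ell$ in $A$ and $B$ respectively (the empty set has codimension $\infty$). A cube complex is a union of finite-dimensional Euclidean unit cubes glued isometrically along faces; here the $2^n$ vertices of an $n$-cube are distinct, and two cubes that meet, meet in a common face. The link of a vertex $v$ has as vertices the vertices adjacent to $v$, and a set $\{v_1,\dots,v_n\}$ of them spans an $(n-1)$-simplex if $v,v_1,\dots,v_n$ are vertices of an $n$-cube. The link is flag if every finite set of pairwise adjacent vertices of it spans a simplex. A cube complex is CAT(0) if it is simply connected and the link of every vertex is flag. **Construction.** Let $X$ be a variety over a field $k$ and $\ell\ge 0$ an integer. A marked pair is a pair $(A,\varphi)$ of a variety $A$ over $k$ and a birational map $\varphi\colon A\dashrightarrow X$ over $k$ that is an isomorphism in codimension $\ell$. Two marked pairs $(A,\varphi)$, $(B,\psi)$ are equivalent if $\varphi^{-1}\psi\colon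 B\dashrightarrow A$ is an isomorphism in codimension $\ell+1$. The vertices of $\mathcal C^\ell(X)$ are the equivalence classes of marked pairs. Distinct vertices $v_1,\dots,v_{2^n}$ form an $n$-cube if one of them has a representative $(A,\varphi)$ for which there are $n$ distinct irreducible closed subvarieties $V_1,\dots,V_n\subset A$ of codimension $\ell+1$ such that $v_1,\dots,v_{2^n}$ are the classes of the pairs $\bigl(A\setminus\bigcup_{i\in I}V_i,\ \varphi|_{A\setminus\bigcup_{i\in I}V_i}\bigr)$, $I\subseteq\{1,\dots,n\}$. In particular, two vertices are joined by an edge if one is the class of some $(A,\varphi)$ and the other the class of $(A\setminus D,\varphi|_{A\setminus D})$, with $D\subset A$ irreducible closed of codimension $\ell+1$. **Theorem.** Let $X$ be a variety of dimension $d$ over a field $k$. For each integer $0\le\ell\le d-1$, $\mathcal C^\ell(X)$ is a CAT(0) cube complex. -/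

import Mathlib

open CategoryTheory AlgebraicGeometry TopologicalSpace

universe u v

/-! ### Cube complexes -/

namespace CubeComplex

/-- The faces of the combinatorial cube `{0,1}ⁿ`: the face of dimension `m` through the corner `b₀`
in the directions `e 0, …, e (m-1)`, parametrized so that `0` goes to `b₀` and the `j`-th coordinate
moves along the direction `e j`. -/
noncomputable def faceCorner {m n : ℕ} (e : Fin m ↪ Fin n) (b₀ : Fin n → Bool)
    (b : Fin m → Bool) : Fin n → Bool := fun i =>
  if b₀ i then !(Function.extend e b (fun _ => false) i)
  else Function.extend e b (fun _ => false) i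

/-- The same face as an isometric affine map `[0,1]ᵐ → [0,1]ⁿ` of Euclidean unit cubes. -/
noncomputable def facePoint {m n : ℕ} (e : Fin m ↪ Fin n) (b₀ : Fin n → Bool)
    (t : Fin m → unitInterval) : Fin n → unitInterval := fun i =>
  if b₀ i then unitInterval.symm (Function.extend e t (fun _ => 0) i)
  else Function.extend e t (fun _ => 0) i

end CubeComplex

/-- A family of cubes on a set `V` of vertices: for each `n`, the collection of those parametrizations
`{0,1}ⁿ → V` of sets of vertices that are declared to be `n`-cubes. -/
structure CubeFamily (V : Type v) where
  /-- `c` parametrizes the corners of an `n`-cube. -/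
  IsCube : (n : ℕ) → ((Fin n → Bool) → V) → Prop

namespace CubeFamily

open CubeComplex

variable {V : Type v} (K : CubeFamily V)

/-- The family of cubes is a cube complex: the `2ⁿ` corners of an `n`-cube are distinct, every
vertex is a `0`-cube, each face of a cube (in each of its parametrizations) is a cube, and two
cubes that meet, meet in a common face. -/
structure IsCubeComplex : Prop where
  injective : ∀ {n : ℕ} {c : (Fin n → Bool) → V}, K.IsCube n c → Function.Injective c
  vertex : ∀ v : V, K.IsCube 0 (fun _ => v)
  face : ∀ {m n : ℕ} {c : (Fin n → Bool) → V} (e : Fin m ↪ Fin n) (b₀ : Fin n → Bool),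
    K.IsCube n c → K.IsCube m (fun b => c (faceCorner e b₀ b))
  inter : ∀ {n n' : ℕ} {c : (Fin n → Bool) → V} {c' : (Fin n' → Bool) → V},
    K.IsCube n c → K.IsCube n' c' → (Set.range c ∩ Set.range c').Nonempty →
    ∃ (m : ℕ) (e : Fin m ↪ Fin n) (b₀ : Fin n → Bool) (e' : Fin m ↪ Fin n') (b₀' : Fin n' → Bool),
      (∀ b, c (faceCorner e b₀ b) = c' (faceCorner e' b₀' b)) ∧
      Set.range (fun b => c (faceCorner e b₀ b)) = Set.range c ∩ Set.range c'

/-- The cubes of `K`, with their parametrizations. -/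
def Cube : Type v := Σ n : ℕ, {c : (Fin n → Bool) → V // K.IsCube n c}

/-- The disjoint union of one Euclidean unit cube `[0,1]ⁿ` for each `n`-cube of `K`. -/
abbrev Points : Type v := Σ σ : K.Cube, (Fin σ.1 → unitInterval)

/-- The gluing: a face of a cube, which is a cube of `K` itself, is identified isometrically with
the corresponding face of the Euclidean cube. (The case `m = n` identifies the different
parametrizations of one and the same cube.) -/
inductive Glue : K.Points → K.Points → Prop
  | face {m n : ℕ} (c : (Fin n → Bool) → V) (hc : K.IsCube n c) (e : Fin m ↪ Fin n)
      (b₀ : Fin n → Bool) (hf : K.IsCube m (fun b => c (faceCorner e b₀ b)))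
      (t : Fin m → unitInterval) :
      Glue ⟨⟨m, ⟨fun b => c (faceCorner e b₀ b), hf⟩⟩, t⟩ ⟨⟨n, ⟨c, hc⟩⟩, facePoint e b₀ t⟩

/-- The geometric realization: the union of the Euclidean cubes, glued along their faces, with the
quotient topology. -/
def Realization : Type v := Quot K.Glue

instance : TopologicalSpace K.Realization := inferInstanceAs (TopologicalSpace (Quot K.Glue))

/-- Two vertices are adjacent if they are the two ends of an edge (a `1`-cube). -/
def Adj (v w : V) : Prop :=
  ∃ c : (Fin 1 → Bool) → V, K.IsCube 1 c ∧ c (fun _ => false) = v ∧ c (fun _ => true) = w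

/-- The simplices of the link of `v`: a set of `n` vertices adjacent to `v` spans a simplex
if together with `v` it is contained in the set of vertices of an `n`-cube. -/
def LinkSimplex (v : V) (s : Finset V) : Prop :=
  (∀ w ∈ s, K.Adj v w) ∧
    ∃ c : (Fin s.card → Bool) → V, K.IsCube s.card c ∧ v ∈ Set.range c ∧ ↑s ⊆ Set.range c

open Classical in
/-- The link of `v` is flag: every finite set of vertices of the link that are pairwise adjacent in
the link spans a simplex of the link. -/
def IsFlagLink (v : V) : Prop :=
  ∀ s : Finset V, (∀ w ∈ s, K.Adj v w) →
    (∀ w ∈ s, ∀ w' ∈ s, w ≠ w' → K.LinkSimplex v {w, w'}) → K.LinkSimplex v s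

/-- A `CAT(0)` cube complex: a simply connected cube complex all of whose links are flag. -/
structure IsCAT0CubeComplex : Prop where
  isCubeComplex : K.IsCubeComplex
  simplyConnected : SimplyConnectedSpace K.Realization
  flag : ∀ v : V, K.IsFlagLink v

end CubeFamily

/-! ### Varieties and birational maps -/

/-- A variety over a field `k`: an integral and separated scheme of finite type over `k`. -/
structure Variety (k : Type u) [Field k] where
  /-- The underlying scheme. -/
  scheme : Scheme.{u}
  /-- The structure morphism. -/
  str : scheme ⟶ Spec (.of k)
  [isIntegral : IsIntegral scheme]
  [isSeparated : IsSeparated str]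
  [locallyOfFiniteType : LocallyOfFiniteType str]
  [quasiCompact : QuasiCompact str]

namespace Variety

attribute [instance] isIntegral isSeparated locallyOfFiniteType quasiCompact

variable {k : Type u} [Field k]

instance (A : Variety k) : A.scheme.Over (Spec (.of k)) := ⟨A.str⟩

instance (A : Variety k) : IsLocallyNoetherian A.scheme :=
  LocallyOfFiniteType.isLocallyNoetherian A.str

/-- A nonempty open subset of a variety, as a variety. -/
noncomputable def openSubvariety (A : Variety k) (U : A.scheme.Opens)
    (hU : (U : Set A.scheme).Nonempty) : Variety k :=
  haveI : Nonempty U := hU.to_subtype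
  { scheme := U
    str := U.ι ≫ A.str }

end Variety

/-- A birational map `A ⇢ B` of varieties over `k`: a dominant rational map over `k` together with
its inverse, which is a dominant rational map over `k` as well. -/
@[ext]
structure BirationalMap {k : Type u} [Field k] (A B : Variety k) where
  /-- The rational map. -/
  hom : A.scheme ⤏ B.scheme
  /-- The inverse rational map. -/
  inv : B.scheme ⤏ A.scheme
  [hom_isDominant : hom.IsDominant]
  [inv_isDominant : inv.IsDominant]
  [hom_isOver : hom.IsOver (Spec (.of k))]
  [inv_isOver : inv.IsOver (Spec (.of k))]
  hom_inv_id : hom.comp inv = Scheme.RationalMap.id A.scheme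
  inv_hom_id : inv.comp hom = Scheme.RationalMap.id B.scheme

namespace BirationalMap

attribute [instance] hom_isDominant inv_isDominant hom_isOver inv_isOver

variable {k : Type u} [Field k] {A B C : Variety k}

/-- The inverse of a birational map. -/
def symm (f : BirationalMap A B) : BirationalMap B A where
  hom := f.inv
  inv := f.hom
  hom_inv_id := f.inv_hom_id
  inv_hom_id := f.hom_inv_id

/-- The composition of birational maps `A ⇢ B` and `B ⇢ C` (in this order). -/
noncomputable def trans (f : BirationalMap A B) (g : BirationalMap B C) : BirationalMap A C where
  hom := f.hom.comp g.hom
  inv := g.inv.comp f.inv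
  hom_inv_id := by
    rw [Scheme.RationalMap.comp_assoc, ← Scheme.RationalMap.comp_assoc g.hom]
    simp only [g.hom_inv_id, Scheme.RationalMap.id_comp, f.hom_inv_id]
  inv_hom_id := by
    rw [Scheme.RationalMap.comp_assoc, ← Scheme.RationalMap.comp_assoc f.inv]
    simp only [f.inv_hom_id, Scheme.RationalMap.id_comp, g.inv_hom_id]

/-- Rational maps that agree after composition with a monomorphism are equal. -/
theorem rationalMap_eq_of_compHom_eq {X Y Z : Scheme.{u}} (j : Y ⟶ Z) [Mono j] {f g : X ⤏ Y}
    (h : f.compHom j = g.compHom j) : f = g := by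
  obtain ⟨f, rfl⟩ := f.exists_rep
  obtain ⟨g, rfl⟩ := g.exists_rep
  rw [← Scheme.RationalMap.compHom_toRationalMap, ← Scheme.RationalMap.compHom_toRationalMap,
    Scheme.PartialMap.toRationalMap_eq_iff] at h
  obtain ⟨W, hW, hl, hr, e⟩ := h
  replace hl : W ≤ f.domain := hl
  replace hr : W ≤ g.domain := hr
  refine Scheme.PartialMap.toRationalMap_eq_iff.mpr ⟨W, hW, hl, hr, ?_⟩
  apply (cancel_mono j).mp
  change X.homOfLE hl ≫ f.hom ≫ j = X.homOfLE hr ≫ g.hom ≫ j at e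
  change (X.homOfLE hl ≫ f.hom) ≫ j = (X.homOfLE hr ≫ g.hom) ≫ j
  rw [Category.assoc, Category.assoc, e]

/-- The inclusion of a nonempty open subset `U` of `A`, as a birational map `U ⇢ A`. Its inverse is
represented by the identity of `U`. -/
noncomputable def ofOpen (A : Variety k) (U : A.scheme.Opens)
    (hU : (U : Set A.scheme).Nonempty) : BirationalMap (A.openSubvariety U hU) A :=
  letI i : (A.openSubvariety U hU).scheme ⟶ A.scheme := U.ι
  letI p : A.scheme.PartialMap (A.openSubvariety U hU).scheme := ⟨U, U.2.dense hU, 𝟙 _⟩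
  haveI : IsDominant i := Opens.isDominant_ι (U.2.dense hU)
  haveI : Mono i := inferInstanceAs (Mono U.ι)
  haveI : IsDominant p.hom := inferInstanceAs (IsDominant (𝟙 (U : Scheme)))
  haveI : i.IsOver (Spec (.of k)) := ⟨rfl⟩
  haveI : p.IsOver (Spec (.of k)) := ⟨Category.id_comp _⟩
  have key : p.toRationalMap.comp i.toRationalMap = Scheme.RationalMap.id A.scheme := by
    rw [Scheme.RationalMap.comp_toRationalMap, ← Scheme.RationalMap.compHom_toRationalMap,
      Scheme.PartialMap.toRationalMap_eq_iff]
    refine ⟨U, U.2.dense hU, le_rfl, le_top, ?_⟩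
    change A.scheme.homOfLE le_rfl ≫ 𝟙 (U : Scheme) ≫ U.ι =
      A.scheme.homOfLE le_top ≫ A.scheme.topIso.hom ≫ 𝟙 A.scheme
    simp
  { hom := i.toRationalMap
    inv := p.toRationalMap
    hom_inv_id := by
      apply rationalMap_eq_of_compHom_eq i
      rw [← Scheme.RationalMap.comp_toRationalMap, Scheme.RationalMap.comp_assoc]
      simp only [key, Scheme.RationalMap.comp_id, Scheme.RationalMap.id_compHom]
    inv_hom_id := key }

/-- The restriction `φ|_U` of a birational map to a nonempty open subset of its source. -/
noncomputable def restrict (φ : BirationalMap A B) (U : A.scheme.Opens)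
    (hU : (U : Set A.scheme).Nonempty) : BirationalMap (A.openSubvariety U hU) B :=
  (ofOpen A U hU).trans φ

/-- The exceptional locus of a birational map `f : A ⇢ B`: the points of `A` that have no open
neighbourhood on which `f` is (defined and) an isomorphism onto an open subset of `B`. -/
def exc (f : BirationalMap A B) : Set A.scheme :=
  {x | ¬ ∃ g : A.scheme.PartialMap B.scheme,
    x ∈ g.domain ∧ g.toRationalMap = f.hom ∧ IsOpenImmersion g.hom}

end BirationalMap

/-- The codimension of a closed subset `Z` of a topological space `T`: the infimum, over all
irreducible closed `W ⊆ Z`, of the supremum of the lengths `n` of chains `W = W₀ ⊊ … ⊊ Wₙ` of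
irreducible closed subsets of `T` (and `∞` if `Z` is empty). -/
noncomputable def codim {T : Type u} [TopologicalSpace T] (Z : Set T) : ℕ∞ :=
  ⨅ (W : IrreducibleCloseds T) (_ : (W : Set T) ⊆ Z), Order.coheight W

/-- A birational map `f : A ⇢ B` is an isomorphism in codimension `l` if the exceptional loci of `f`
and of `f⁻¹` have codimension `> l` in `A` and in `B`, respectively. -/
def BirationalMap.IsIsoInCodim {k : Type u} [Field k] {A B : Variety k} (l : ℕ)
    (f : BirationalMap A B) : Prop :=
  (l : ℕ∞) < codim f.exc ∧ (l : ℕ∞) < codim f.symm.exc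

/-! ### The cube complex of a variety -/

section

variable {k : Type u} [Field k]

/-- A marked pair `(A, φ)`: a variety `A` over `k` and an isomorphism in codimension `l`
`φ : A ⇢ X`. -/
structure MarkedPair (l : ℕ) (X : Variety k) where
  /-- The variety. -/
  var : Variety k
  /-- The marking. -/
  map : BirationalMap var X
  isIsoInCodim : map.IsIsoInCodim l

namespace MarkedPair

variable {l : ℕ} {X : Variety k}

/-- `(A, φ)` and `(B, ψ)` are equivalent if `φ⁻¹ψ : B ⇢ A` is an isomorphism in
codimension `l + 1`. (This is an equivalence relation.) -/
def Equivalent (M N : MarkedPair l X) : Prop :=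
  (N.map.trans M.map.symm).IsIsoInCodim (l + 1)

end MarkedPair

/-- The vertices of the cube complex: classes of marked pairs modulo equivalence. -/
def MarkedVertex (l : ℕ) (X : Variety k) : Type (u + 1) :=
  Quot (MarkedPair.Equivalent (l := l) (X := X))

/-- `v` is the class of `(U, φ|_U)`, for a marked pair `M = (A, φ)` and a nonempty open `U ⊆ A`. -/
def MarkedVertex.IsRestriction {l : ℕ} {X : Variety k} (v : MarkedVertex l X) (M : MarkedPair l X)
    (U : M.var.scheme.Opens) : Prop :=
  ∃ (hU : (U : Set M.var.scheme).Nonempty) (h : (M.map.restrict U hU).IsIsoInCodim l),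
    v = Quot.mk _ ⟨M.var.openSubvariety U hU, M.map.restrict U hU, h⟩

/-- The complement of the union of finitely many irreducible closed subsets `D i`, `i ∈ s`. -/
def removeAll {T : Type u} [TopologicalSpace T] {n : ℕ} (D : Fin n → IrreducibleCloseds T)
    (s : Set (Fin n)) : Opens T where
  carrier := (⋃ i ∈ s, (D i : Set T))ᶜ
  is_open' := (s.toFinite.isClosed_biUnion fun i _ => (D i).isClosed).isOpen_compl

/-- The cube complex `𝒞^l(X)`. Distinct vertices `c b`, `b ∈ {0,1}ⁿ`, are the corners of an
`n`-cube if there are a representative `(A, φ)` of one of them, `c b₀`, and `n` distinct irreducible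
closed subvarieties `D i` of `A` of codimension `l + 1` such that `c b` is represented by
`(A ∖ ⋃ D i, φ|)`, where `i` runs through the coordinates in which `b` differs from `b₀`. -/
def birationalCubeComplex (l : ℕ) (X : Variety k) : CubeFamily (MarkedVertex l X) where
  IsCube n c := Function.Injective c ∧
    ∃ (b₀ : Fin n → Bool) (M : MarkedPair l X) (D : Fin n → IrreducibleCloseds M.var.scheme),
      c b₀ = Quot.mk _ M ∧ Function.Injective D ∧
      (∀ i, codim (D i : Set M.var.scheme) = (l + 1 : ℕ)) ∧
      ∀ b, (c b).IsRestriction M (removeAll D {i | b i ≠ b₀ i})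

end

/-! ### Cube families of sets -/

namespace CubeComplex

theorem faceCorner_apply {m n : ℕ} (e : Fin m ↪ Fin n) (b₀ : Fin n → Bool) (b : Fin m → Bool)
    (j : Fin m) : faceCorner e b₀ b (e j) = xor (b₀ (e j)) (b j) := by
  unfold faceCorner
  rw [e.injective.extend_apply]
  cases b₀ (e j) <;> simp

theorem faceCorner_of_notMem {m n : ℕ} (e : Fin m ↪ Fin n) (b₀ : Fin n → Bool)
    (b : Fin m → Bool) {i : Fin n} (hi : ¬ ∃ j, e j = i) : faceCorner e b₀ b i = b₀ i := by
  unfold faceCorner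
  rw [Function.extend_apply' _ _ _ hi]
  cases b₀ i <;> simp

theorem facePoint_apply {m n : ℕ} (e : Fin m ↪ Fin n) (b₀ : Fin n → Bool)
    (t : Fin m → unitInterval) (j : Fin m) :
    facePoint e b₀ t (e j) = if b₀ (e j) then unitInterval.symm (t j) else t j := by
  unfold facePoint
  rw [e.injective.extend_apply]

theorem facePoint_of_notMem {m n : ℕ} (e : Fin m ↪ Fin n) (b₀ : Fin n → Bool)
    (t : Fin m → unitInterval) {i : Fin n} (hi : ¬ ∃ j, e j = i) :
    facePoint e b₀ t i = if b₀ i then 1 else 0 := by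
  unfold facePoint
  rw [Function.extend_apply' _ _ _ hi]
  simp

end CubeComplex

namespace CubeFamily

open CubeComplex

variable {V : Type v} {E : Type*}

/-- With respect to the assignment `v ↦ S v` of sets to vertices, the corners of `c` arise from the
corner `b₀` by removing elements among the distinct `D i ∈ S (c b₀)`. -/
structure IsSetCube (S : V → Set E) {n : ℕ} (c : (Fin n → Bool) → V) (b₀ : Fin n → Bool)
    (D : Fin n → E) : Prop where
  injective : Function.Injective D
  mem : ∀ i, D i ∈ S (c b₀)
  eq : ∀ b, S (c b) = S (c b₀) \ D '' {i | b i ≠ b₀ i}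

/-- The family `K` is modelled on a family of commensurable sets that is closed under the removal of
finitely many elements, and under finite unions if it is so pairwise. -/
structure IsSetModel (K : CubeFamily V) (S : V → Set E) : Prop where
  injective : Function.Injective S
  finite_diff : ∀ v w, (S v \ S w).Finite
  exists_diff : ∀ v (F : Set E), F.Finite → ∃ w, S w = S v \ F
  exists_union : ∀ v (T : Finset E), (∀ a ∈ T, ∀ b ∈ T, ∃ w, S w = S v ∪ {a, b}) →
    ∃ w, S w = S v ∪ T
  isCube_iff : ∀ {n : ℕ} (c : (Fin n → Bool) → V),
    K.IsCube n c ↔ ∃ b₀ D, IsSetCube S c b₀ D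

namespace IsSetCube

variable {S : V → Set E} {n : ℕ} {c : (Fin n → Bool) → V} {b₀ : Fin n → Bool} {D : Fin n → E}

theorem mem_iff (h : IsSetCube S c b₀ D) (b : Fin n → Bool) (i : Fin n) :
    D i ∈ S (c b) ↔ b i = b₀ i := by
  rw [h.eq b]
  constructor
  · intro hi
    by_contra hne
    exact hi.2 ⟨i, hne, rfl⟩
  · intro hi
    refine ⟨h.mem i, ?_⟩
    rintro ⟨j, hj, hji⟩
    rw [h.injective hji] at hj
    exact hj hi

theorem mem_iff_of_notMem (h : IsSetCube S c b₀ D) (b : Fin n → Bool) {x : E}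
    (hx : x ∉ Set.range D) : x ∈ S (c b) ↔ x ∈ S (c b₀) := by
  rw [h.eq b]
  refine ⟨fun hi => hi.1, fun hi => ⟨hi, ?_⟩⟩
  rintro ⟨j, -, hj⟩
  exact hx ⟨j, hj⟩

theorem corner_injective (h : IsSetCube S c b₀ D) : Function.Injective c := by
  intro b b' hb
  funext i
  have := h.mem_iff b i
  rw [hb, h.mem_iff b' i] at this
  revert this
  cases b i <;> cases b' i <;> cases b₀ i <;> simp

theorem subset (h : IsSetCube S c b₀ D) (b : Fin n → Bool) : S (c b) ⊆ S (c b₀) := by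
  rw [h.eq b]
  exact Set.sdiff_subset

theorem unique (hS : Function.Injective S) (h : IsSetCube S c b₀ D) {b₁ : Fin n → Bool}
    {D₁ : Fin n → E} (h₁ : IsSetCube S c b₁ D₁) : b₀ = b₁ ∧ D = D₁ := by
  have hb : b₀ = b₁ :=
    h.corner_injective (hS (subset_antisymm (h₁.subset b₀) (h.subset b₁)))
  subst hb
  refine ⟨rfl, funext fun i => ?_⟩
  have h1 : D i ∉ S (c (Function.update b₀ i (!b₀ i))) := by
    rw [h.mem_iff]; simp
  rw [h₁.eq] at h1
  by_contra hne
  refine h1 ⟨h.mem i, ?_⟩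
  rintro ⟨j, hj, hji⟩
  by_cases hji' : j = i
  · subst hji'
    exact hne hji.symm
  · simp [Function.update_of_ne hji'] at hj

/-- The coordinates of the face corner that is the maximum of a face. -/
theorem face (h : IsSetCube S c b₀ D) {m : ℕ} (e : Fin m ↪ Fin n) (b₁ : Fin n → Bool) :
    IsSetCube S (fun b => c (faceCorner e b₁ b)) (fun j => xor (b₁ (e j)) (b₀ (e j))) (D ∘ e) where
  injective := h.injective.comp e.injective
  mem j := by
    change D (e j) ∈ _
    rw [h.mem_iff, faceCorner_apply]
    cases b₁ (e j) <;> simp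
  eq b := by
    ext x
    by_cases hx : x ∈ Set.range D
    · obtain ⟨i, rfl⟩ := hx
      rw [Set.mem_sdiff]
      simp only [h.mem_iff]
      by_cases hi : ∃ j, e j = i
      · obtain ⟨j, rfl⟩ := hi
        have : (D (e j) ∈ (D ∘ e) '' {i | b i ≠ xor (b₁ (e i)) (b₀ (e i))}) ↔
            b j ≠ xor (b₁ (e j)) (b₀ (e j)) :=
          (h.injective.comp e.injective).mem_set_image (a := j)
        rw [this]
        simp only [faceCorner_apply]
        cases b j <;> cases b₁ (e j) <;> cases b₀ (e j) <;> simp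
      · rw [faceCorner_of_notMem _ _ _ hi, faceCorner_of_notMem _ _ _ hi]
        refine ⟨fun h' => ⟨h', ?_⟩, fun h' => h'.1⟩
        rintro ⟨j, -, hj⟩
        exact hi ⟨j, h.injective hj⟩
    · rw [Set.mem_sdiff]
      simp only [h.mem_iff_of_notMem _ hx]
      refine ⟨fun h' => ⟨h', ?_⟩, fun h' => h'.1⟩
      rintro ⟨j, -, hj⟩
      exact hx ⟨e j, hj⟩

/-- The corners of the common face of `c` and another cube, in terms of the sets. -/
theorem face_eq (h : IsSetCube S c b₀ D) {m : ℕ} (e : Fin m ↪ Fin n) (β : Fin n → Bool) 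
    (b₁ : Fin n → Bool) (he : ∀ j, b₁ (e j) = !b₀ (e j)) (hn : ∀ i, (¬ ∃ j, e j = i) → b₁ i = β i)
    (b : Fin m → Bool) :
    S (c (faceCorner e b₁ b)) =
      (S (c β) ∪ Set.range (D ∘ e)) \ (D ∘ e) '' {j | b j = false} := by
  ext x
  by_cases hx : x ∈ Set.range D
  · obtain ⟨i, rfl⟩ := hx
    rw [Set.mem_sdiff, Set.mem_union, h.mem_iff, h.mem_iff]
    by_cases hi : ∃ j, e j = i
    · obtain ⟨j, rfl⟩ := hi
      have : (D (e j) ∈ (D ∘ e) '' {j | b j = false}) ↔ b j = false :=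
        (h.injective.comp e.injective).mem_set_image (a := j)
      rw [this, faceCorner_apply, he]
      have : D (e j) ∈ Set.range (D ∘ e) := ⟨j, rfl⟩
      simp only [this, or_true, true_and]
      cases b j <;> cases b₀ (e j) <;> simp
    · rw [faceCorner_of_notMem _ _ _ hi, hn i hi]
      have h1 : D i ∉ Set.range (D ∘ e) := fun ⟨j, hj⟩ => hi ⟨j, h.injective hj⟩
      have h2 : D i ∉ (D ∘ e) '' {j | b j = false} := fun h2 => h1 (Set.image_subset_range _ _ h2)
      simp only [h1, h2, or_false, not_false_eq_true, and_true]
  · have h1 : x ∉ Set.range (D ∘ e) := fun ⟨j, hj⟩ => hx ⟨e j, hj⟩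
    have h2 : x ∉ (D ∘ e) '' {j | b j = false} := fun h2 => h1 (Set.image_subset_range _ _ h2)
    rw [Set.mem_sdiff, Set.mem_union, h.mem_iff_of_notMem _ hx, h.mem_iff_of_notMem _ hx]
    simp only [h1, h2, or_false, not_false_eq_true, and_true]
    exact (h.mem_iff_of_notMem _ hx).symm

end IsSetCube

namespace IsSetModel

variable {K : CubeFamily V} {S : V → Set E} (hK : K.IsSetModel S)

include hK

theorem inter_eq_face {n n' : ℕ} {c : (Fin n → Bool) → V} {c' : (Fin n' → Bool) → V}
    (hc : K.IsCube n c) (hc' : K.IsCube n' c') (hne : (Set.range c ∩ Set.range c').Nonempty) :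
    ∃ (m : ℕ) (e : Fin m ↪ Fin n) (b₀ : Fin n → Bool) (e' : Fin m ↪ Fin n') (b₀' : Fin n' → Bool),
      (∀ b, c (faceCorner e b₀ b) = c' (faceCorner e' b₀' b)) ∧
      Set.range (fun b => c (faceCorner e b₀ b)) = Set.range c ∩ Set.range c' := by
  classical
  obtain ⟨b₀, D, h⟩ := (hK.isCube_iff c).1 hc
  obtain ⟨b₀', D', h'⟩ := (hK.isCube_iff c').1 hc'
  obtain ⟨_, ⟨β, rfl⟩, ⟨β', hβ⟩⟩ := hne
  let G : Finset (Fin n) := Finset.univ.filter fun i => D i ∈ Set.range D'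
  let e : Fin G.card ↪ Fin n := (G.orderEmbOfFin rfl).toEmbedding
  have he : ∀ i, (∃ j, e j = i) ↔ D i ∈ Set.range D' := by
    intro i
    have : i ∈ Set.range (G.orderEmbOfFin rfl) ↔ i ∈ (G : Set (Fin n)) := by
      rw [Finset.range_orderEmbOfFin]
    simp only [G, Finset.coe_filter, Finset.mem_univ, true_and, Set.mem_ofPred_eq] at this
    exact this
  choose e' he' using fun j => (he (e j)).1 ⟨j, rfl⟩
  have hinj : Function.Injective e' := fun j₁ j₂ hj =>
    e.injective (h.injective (by rw [← he', ← he', hj]))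
  let e₁ : Fin G.card ↪ Fin n' := ⟨e', hinj⟩
  have hDe : D ∘ e = D' ∘ e₁ := funext fun j => (he' j).symm
  have he₁ : ∀ i, (∃ j, e₁ j = i) ↔ D' i ∈ Set.range D := by
    intro i
    constructor
    · rintro ⟨j, rfl⟩
      exact ⟨e j, (he' j).symm⟩
    · rintro ⟨i', hi'⟩
      obtain ⟨j, rfl⟩ := (he i').2 ⟨i, hi'.symm⟩
      exact ⟨j, h'.injective ((he' j).trans hi')⟩
  let b₁ : Fin n → Bool := fun i => if ∃ j, e j = i then !b₀ i else β i
  let b₁' : Fin n' → Bool := fun i => if ∃ j, e₁ j = i then !b₀' i else β' i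
  have hb₁ : ∀ j, b₁ (e j) = !b₀ (e j) := fun j => if_pos ⟨j, rfl⟩
  have hb₁' : ∀ j, b₁' (e₁ j) = !b₀' (e₁ j) := fun j => if_pos ⟨j, rfl⟩
  have hn₁ : ∀ i, (¬ ∃ j, e j = i) → b₁ i = β i := fun i hi => if_neg hi
  have hn₁' : ∀ i, (¬ ∃ j, e₁ j = i) → b₁' i = β' i := fun i hi => if_neg hi
  have key : ∀ b, c (faceCorner e b₁ b) = c' (faceCorner e₁ b₁' b) := by
    intro b
    apply hK.injective
    rw [h.face_eq e β b₁ hb₁ hn₁, h'.face_eq e₁ β' b₁' hb₁' hn₁', hDe, hβ]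
  refine ⟨G.card, e, b₁, e₁, b₁', key, subset_antisymm ?_ ?_⟩
  · rintro _ ⟨b, rfl⟩
    exact ⟨⟨_, rfl⟩, ⟨_, (key b).symm⟩⟩
  · rintro _ ⟨⟨γ, rfl⟩, ⟨γ', hγ⟩⟩
    refine ⟨fun j => xor (b₁ (e j)) (γ (e j)), ?_⟩
    dsimp only
    congr 1
    funext i
    by_cases hi : ∃ j, e j = i
    · obtain ⟨j, rfl⟩ := hi
      rw [faceCorner_apply]
      cases b₁ (e j) <;> simp
    · rw [faceCorner_of_notMem _ _ _ hi, hn₁ i hi]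
      have hD : D i ∉ Set.range D' := fun h1 => hi ((he i).2 h1)
      have h1 := h'.mem_iff_of_notMem β' hD
      have h2 := h'.mem_iff_of_notMem γ' hD
      rw [hβ, h.mem_iff] at h1
      rw [hγ, h.mem_iff] at h2
      revert h1 h2
      cases β i <;> cases γ i <;> cases b₀ i <;> simp

theorem isCubeComplex : K.IsCubeComplex where
  injective hc := by
    obtain ⟨b₀, D, h⟩ := (hK.isCube_iff _).1 hc
    exact h.corner_injective
  vertex v := (hK.isCube_iff _).2 ⟨fun _ => false, Fin.elim0,
    ⟨fun i => i.elim0, fun i => i.elim0, fun b => by simp [Set.eq_empty_of_isEmpty]⟩⟩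
  face e b₁ hc := by
    obtain ⟨b₀, D, h⟩ := (hK.isCube_iff _).1 hc
    exact (hK.isCube_iff _).2 ⟨_, _, h.face e b₁⟩
  inter hc hc' hne := hK.inter_eq_face hc hc' hne

/-- The cube of all vertices obtained from `v` by removing some of the `D i`. -/
noncomputable def cube (v : V) {n : ℕ} (D : Fin n → E) (b : Fin n → Bool) : V :=
  (hK.exists_diff v (D '' {i | b i = false}) (Set.toFinite _)).choose

theorem cube_eq (v : V) {n : ℕ} (D : Fin n → E) (b : Fin n → Bool) :
    S (hK.cube v D b) = S v \ D '' {i | b i = false} :=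
  (hK.exists_diff v (D '' {i | b i = false}) (Set.toFinite _)).choose_spec

theorem cube_true (v : V) {n : ℕ} (D : Fin n → E) : hK.cube v D (fun _ => true) = v := by
  apply hK.injective
  rw [hK.cube_eq]
  simp

theorem isSetCube_cube (v : V) {n : ℕ} {D : Fin n → E} (hD : Function.Injective D)
    (hv : ∀ i, D i ∈ S v) : IsSetCube S (hK.cube v D) (fun _ => true) D where
  injective := hD
  mem i := by rw [hK.cube_true]; exact hv i
  eq b := by
    rw [hK.cube_true, hK.cube_eq]
    simp

theorem isCube_cube (v : V) {n : ℕ} {D : Fin n → E} (hD : Function.Injective D)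
    (hv : ∀ i, D i ∈ S v) : K.IsCube n (hK.cube v D) :=
  (hK.isCube_iff _).2 ⟨_, _, hK.isSetCube_cube v hD hv⟩

theorem symmDiff_of_adj {v w : V} (h : K.Adj v w) : ∃ a, S w = symmDiff (S v) {a} := by
  obtain ⟨c, hc, rfl, rfl⟩ := h
  obtain ⟨b₀, D, h⟩ := (hK.isCube_iff _).1 hc
  refine ⟨D 0, ?_⟩
  ext x
  rw [Set.mem_symmDiff, Set.mem_singleton_iff]
  by_cases hx : x = D 0
  · subst hx
    rw [h.mem_iff, h.mem_iff]
    cases b₀ 0 <;> simp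
  · have hx' : x ∉ Set.range D := by
      rintro ⟨i, rfl⟩
      exact hx (by rw [Subsingleton.elim i 0])
    rw [h.mem_iff_of_notMem _ hx', h.mem_iff_of_notMem (fun _ => false) hx']
    tauto

/-- The union of the sets of the corners of a cube is again one of the sets, even after removing
finitely many elements. -/
theorem exists_eq_of_isCube {n : ℕ} {c : (Fin n → Bool) → V} (hc : K.IsCube n c) {v : V}
    {T : Set E} (hvT : S v ⊆ T) (hT : ∀ x ∈ T, ∃ w ∈ Set.range c, x ∈ S w) :
    ∃ w, S w = T := by
  obtain ⟨b₀, D, h⟩ := (hK.isCube_iff _).1 hc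
  have hsub : T ⊆ S (c b₀) := by
    intro x hx
    obtain ⟨_, ⟨b, rfl⟩, hw⟩ := hT x hx
    exact h.subset b hw
  obtain ⟨w, hw⟩ := hK.exists_diff (c b₀) (S (c b₀) \ T)
    ((hK.finite_diff (c b₀) v).subset (Set.sdiff_subset_sdiff_right hvT))
  exact ⟨w, by rw [hw, Set.sdiff_sdiff_cancel_left hsub]⟩

theorem isFlagLink (v : V) : K.IsFlagLink v := by
  classical
  intro s hs hpair
  refine ⟨hs, ?_⟩
  choose a ha using fun w : s => hK.symmDiff_of_adj (hs w w.2)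
  have hinj : Function.Injective a := fun w w' hw =>
    Subtype.ext (hK.injective (by rw [ha, ha, hw]))
  have mem_of_ne : ∀ (w : s) (x : E), x ≠ a w → (x ∈ S w ↔ x ∈ S v) := by
    intro w x hx
    rw [ha, Set.mem_symmDiff, Set.mem_singleton_iff]
    tauto
  have mem_self : ∀ w : s, a w ∈ S w ↔ a w ∉ S v := by
    intro w
    rw [ha, Set.mem_symmDiff, Set.mem_singleton_iff]
    tauto
  obtain ⟨u, hu⟩ := hK.exists_union v ((Finset.univ.filter fun w : s => a w ∉ S v).image a) (by
    intro x hx y hy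
    simp only [Finset.mem_image, Finset.mem_filter, Finset.mem_univ, true_and] at hx hy
    obtain ⟨w, hw, rfl⟩ := hx
    obtain ⟨w', hw', rfl⟩ := hy
    by_cases hne : w = w'
    · subst hne
      refine ⟨w, ?_⟩
      ext x
      by_cases hx : x = a w
      · subst hx
        simpa [mem_self] using hw
      · simp [mem_of_ne w x hx, hx]
    · obtain ⟨-, c, hc, hv, hsub⟩ := hpair w w.2 w' w'.2 fun h => hne (Subtype.ext h)
      refine hK.exists_eq_of_isCube hc (v := v) Set.subset_union_left ?_
      rintro x (hx | rfl | rfl)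
      · exact ⟨v, hv, hx⟩
      · exact ⟨w, hsub (by simp), (mem_self w).2 hw⟩
      · exact ⟨w', hsub (by simp), (mem_self w').2 hw'⟩)
  have memu : ∀ w : s, a w ∈ S u := by
    intro w
    rw [hu]
    by_cases hw : a w ∈ S v
    · exact Or.inl hw
    · refine Or.inr ?_
      simp only [Finset.coe_image, Set.mem_image, Finset.mem_coe, Finset.mem_filter,
        Finset.mem_univ, true_and]
      exact ⟨w, hw, rfl⟩
  have memu' : ∀ x, x ∉ Set.range a → (x ∈ S u ↔ x ∈ S v) := by
    intro x hx
    rw [hu, Set.mem_union, or_iff_left]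
    simp only [Finset.coe_image, Set.mem_image, not_exists, not_and]
    exact fun w _ hw => hx ⟨w, hw⟩
  let D : Fin s.card → E := a ∘ s.equivFin.symm
  have hD : Function.Injective D := hinj.comp s.equivFin.symm.injective
  have hDu : ∀ i, D i ∈ S u := fun i => memu _
  have hcube := hK.isSetCube_cube u hD hDu
  have key : ∀ w : V, (∀ x, x ∉ Set.range a → (x ∈ S w ↔ x ∈ S v)) →
      w ∈ Set.range (hK.cube u D) := by
    intro w hw
    refine ⟨fun i => decide (D i ∈ S w), hK.injective ?_⟩
    ext x
    by_cases hx : x ∈ Set.range D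
    · obtain ⟨i, rfl⟩ := hx
      rw [hcube.mem_iff]
      simp
    · rw [hcube.mem_iff_of_notMem _ hx, hK.cube_true]
      have hx' : x ∉ Set.range a := by
        rintro ⟨w, rfl⟩
        exact hx ⟨s.equivFin w, by simp [D]⟩
      rw [memu' x hx', hw x hx']
  refine ⟨hK.cube u D, hK.isCube_cube u hD hDu, key v fun _ _ => Iff.rfl, ?_⟩
  intro w hw
  exact key w fun x hx => mem_of_ne ⟨w, hw⟩ x fun h => hx ⟨_, h.symm⟩

end IsSetModel

end CubeFamily

namespace CubeComplex

open Classical in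
/-- The point with coordinates `t` of the cube of all sets between `A ∖ {D i}` and `A`, as a
function on the ambient set. -/
noncomputable def pointFun {E : Type*} (A : Set E) {n : ℕ} (D : Fin n → E)
    (t : Fin n → unitInterval) (x : E) : unitInterval :=
  if x ∈ A then Function.extend D t (fun _ => 1) x else 0

section

variable {E : Type*} {A : Set E} {n : ℕ} {D : Fin n → E} {t : Fin n → unitInterval}

theorem pointFun_of_notMem {x : E} (hx : x ∉ A) : pointFun A D t x = 0 := if_neg hx

theorem pointFun_of_notMem_range {x : E} (hx : x ∈ A) (hx' : x ∉ Set.range D) :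
    pointFun A D t x = 1 := by
  unfold pointFun
  rw [if_pos hx, Function.extend_apply' _ _ _ hx']

theorem pointFun_apply (hD : Function.Injective D) (hA : ∀ i, D i ∈ A) (i : Fin n) :
    pointFun A D t (D i) = t i := by
  unfold pointFun
  rw [if_pos (hA i), hD.extend_apply]

theorem continuous_pointFun (hD : Function.Injective D) (x : E) :
    Continuous fun t => pointFun A D t x := by
  unfold pointFun
  by_cases hx : x ∈ A
  · by_cases hx' : ∃ i, D i = x
    · obtain ⟨i, rfl⟩ := hx'
      simp only [hx, if_true, hD.extend_apply]
      exact continuous_apply i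
    · simp only [hx, if_true, Function.extend_apply' _ _ _ hx']
      exact continuous_const
  · simp only [hx, if_false]
    exact continuous_const

/-- A function with values in the unit interval is a point of the cube below `A` with directions `D`
as soon as it is `0` outside `A` and `1` on the rest of `A`. -/
theorem pointFun_comp (hD : Function.Injective D) (hA : ∀ i, D i ∈ A) {f : E → unitInterval}
    (h0 : ∀ x ∉ A, f x = 0) (h1 : ∀ x ∈ A, x ∉ Set.range D → f x = 1) :
    pointFun A D (f ∘ D) = f := by
  funext x
  by_cases hx : x ∈ A
  · by_cases hx' : x ∈ Set.range D
    · obtain ⟨i, rfl⟩ := hx'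
      rw [pointFun_apply hD hA, Function.comp_apply]
    · rw [pointFun_of_notMem_range hx hx', h1 x hx hx']
  · rw [pointFun_of_notMem hx, h0 x hx]

end

theorem continuous_facePoint {m n : ℕ} (e : Fin m ↪ Fin n) (b₀ : Fin n → Bool) :
    Continuous (facePoint e b₀) := by
  refine continuous_pi fun i => ?_
  by_cases hi : ∃ j, e j = i
  · obtain ⟨j, rfl⟩ := hi
    simp only [facePoint_apply]
    split_ifs <;> fun_prop
  · simp only [facePoint_of_notMem _ _ _ hi]
    exact continuous_const

/-- The coordinates of a point of a cube after the reflection that makes the corner `b₀` the last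
one. -/
noncomputable def orient {n : ℕ} (b₀ : Fin n → Bool) (t : Fin n → unitInterval) (i : Fin n) :
    unitInterval :=
  if b₀ i then t i else unitInterval.symm (t i)

theorem orient_true {n : ℕ} (t : Fin n → unitInterval) : orient (fun _ => true) t = t := by
  funext i; simp [orient]

end CubeComplex

namespace CubeFamily

open CubeComplex

variable {V : Type v} {E : Type*}

namespace IsSetCube

variable {S : V → Set E} {n : ℕ} {c : (Fin n → Bool) → V} {b₀ : Fin n → Bool} {D : Fin n → E}

theorem pointFun_facePoint (h : IsSetCube S c b₀ D) {m : ℕ} (e : Fin m ↪ Fin n)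
    (b₁ : Fin n → Bool) (t : Fin m → unitInterval) :
    pointFun (S (c (faceCorner e b₁ fun j => xor (b₁ (e j)) (b₀ (e j))))) (D ∘ e)
      (orient (fun j => xor (b₁ (e j)) (b₀ (e j))) t) =
    pointFun (S (c b₀)) D (orient b₀ (facePoint e b₁ t)) := by
  have hf := h.face e b₁
  funext x
  by_cases hx : x ∈ Set.range D
  · obtain ⟨i, rfl⟩ := hx
    rw [pointFun_apply h.injective h.mem]
    by_cases hi : ∃ j, e j = i
    · obtain ⟨j, rfl⟩ := hi
      refine (pointFun_apply hf.injective hf.mem j).trans ?_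
      rw [orient, orient, facePoint_apply]
      cases b₁ (e j) <;> cases b₀ (e j) <;> simp
    · have hi' : D i ∉ Set.range (D ∘ e) := fun ⟨j, hj⟩ => hi ⟨j, h.injective hj⟩
      rw [orient, facePoint_of_notMem _ _ _ hi]
      by_cases hb : b₁ i = b₀ i
      · rw [pointFun_of_notMem_range ((h.mem_iff _ _).2
          ((faceCorner_of_notMem _ _ _ hi).trans hb)) hi', hb]
        cases b₀ i <;> simp
      · rw [pointFun_of_notMem (fun h' => hb
          ((faceCorner_of_notMem _ _ _ hi).symm.trans ((h.mem_iff _ _).1 h')))]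
        revert hb
        cases b₀ i <;> cases b₁ i <;> simp
  · have hx' : x ∉ Set.range (D ∘ e) := fun ⟨j, hj⟩ => hx ⟨e j, hj⟩
    by_cases hxS : x ∈ S (c b₀)
    · rw [pointFun_of_notMem_range hxS hx, pointFun_of_notMem_range
        ((h.mem_iff_of_notMem _ hx).2 hxS) hx']
    · rw [pointFun_of_notMem hxS, pointFun_of_notMem
        (fun h' => hxS ((h.mem_iff_of_notMem _ hx).1 h'))]

end IsSetCube

namespace IsSetModel

variable {K : CubeFamily V} {S : V → Set E} (hK : K.IsSetModel S)

include hK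

theorem exists_pointsFun (σ : K.Cube) : ∃ f : (Fin σ.1 → unitInterval) → E → unitInterval,
    ∀ b₀ D, IsSetCube S σ.2.1 b₀ D → ∀ t, f t = pointFun (S (σ.2.1 b₀)) D (orient b₀ t) := by
  obtain ⟨b₀, D, h⟩ := (hK.isCube_iff _).1 σ.2.2
  refine ⟨fun t => pointFun (S (σ.2.1 b₀)) D (orient b₀ t), fun b₁ D₁ h₁ t => ?_⟩
  obtain ⟨rfl, rfl⟩ := h.unique hK.injective h₁
  rfl

/-- The function on the ambient set that is attached to a point of a cube. -/
noncomputable def pointsFun (p : K.Points) : E → unitInterval :=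
  (hK.exists_pointsFun p.1).choose p.2

theorem pointsFun_eq {n : ℕ} {c : (Fin n → Bool) → V} (hc : K.IsCube n c) {b₀ : Fin n → Bool}
    {D : Fin n → E} (h : IsSetCube S c b₀ D) (t : Fin n → unitInterval) :
    hK.pointsFun ⟨⟨n, ⟨c, hc⟩⟩, t⟩ = pointFun (S (c b₀)) D (orient b₀ t) :=
  (hK.exists_pointsFun ⟨n, ⟨c, hc⟩⟩).choose_spec b₀ D h t

/-- The function on the ambient set that is attached to a point of the geometric realization. -/
noncomputable def realizationFun : K.Realization → E → unitInterval :=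
  Quot.lift hK.pointsFun (by
    rintro _ _ ⟨c, hc, e, b₁, hf, t⟩
    obtain ⟨b₀, D, h⟩ := (hK.isCube_iff _).1 hc
    rw [hK.pointsFun_eq hc h, hK.pointsFun_eq hf (h.face e b₁)]
    exact h.pointFun_facePoint e b₁ t)

/-- The point with coordinates `t` of the cube of all vertices below `v` in the directions `D`. -/
noncomputable def point (v : V) {n : ℕ} {D : Fin n → E} (hD : Function.Injective D)
    (hv : ∀ i, D i ∈ S v) (t : Fin n → unitInterval) : K.Realization :=
  Quot.mk _ ⟨⟨n, ⟨hK.cube v D, hK.isCube_cube v hD hv⟩⟩, t⟩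

theorem continuous_point (v : V) {n : ℕ} {D : Fin n → E} (hD : Function.Injective D)
    (hv : ∀ i, D i ∈ S v) : Continuous (hK.point v hD hv) :=
  (continuous_quot_mk (r := K.Glue)).comp
    (continuous_sigmaMk (σ := fun σ : K.Cube => Fin σ.1 → unitInterval))

theorem realizationFun_point (v : V) {n : ℕ} {D : Fin n → E} (hD : Function.Injective D)
    (hv : ∀ i, D i ∈ S v) (t : Fin n → unitInterval) :
    hK.realizationFun (hK.point v hD hv t) = pointFun (S v) D t := by
  refine (hK.pointsFun_eq _ (hK.isSetCube_cube v hD hv) t).trans ?_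
  rw [hK.cube_true, orient_true]

/-- A face inclusion between two of the cubes below vertices. -/
theorem point_eq_point_facePoint {v w : V} {m n : ℕ} {D : Fin n → E} (hD : Function.Injective D)
    (hv : ∀ i, D i ∈ S v) {D' : Fin m → E} (hD' : Function.Injective D') (hw : ∀ i, D' i ∈ S w)
    (e : Fin m ↪ Fin n) (b₁ : Fin n → Bool)
    (h : ∀ b, hK.cube w D' b = hK.cube v D (faceCorner e b₁ b)) (t : Fin m → unitInterval) :
    hK.point w hD' hw t = hK.point v hD hv (facePoint e b₁ t) := by
  have hc := hK.isCube_cube v hD hv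
  have hf := hK.isCubeComplex.face e b₁ hc
  have : (⟨hK.cube w D', hK.isCube_cube w hD' hw⟩ : {c // K.IsCube m c}) =
      ⟨fun b => hK.cube v D (faceCorner e b₁ b), hf⟩ := Subtype.ext (funext h)
  unfold point
  rw [this]
  exact Quot.sound (Glue.face _ hc e b₁ hf t)

theorem mk_eq_point {n : ℕ} {c : (Fin n → Bool) → V} (hc : K.IsCube n c) :
    ∃ (v : V) (D : Fin n → E) (hD : Function.Injective D) (hv : ∀ i, D i ∈ S v)
      (φ : (Fin n → unitInterval) → Fin n → unitInterval), Continuous φ ∧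
      ∀ t, (Quot.mk _ ⟨⟨n, ⟨c, hc⟩⟩, t⟩ : K.Realization) = hK.point v hD hv (φ t) := by
  obtain ⟨b₀, D, h⟩ := (hK.isCube_iff _).1 hc
  have hcube := hK.isCube_cube (c b₀) h.injective h.mem
  refine ⟨c b₀, D, h.injective, h.mem,
    facePoint (Function.Embedding.refl _) (fun i => !b₀ i), continuous_facePoint _ _, fun t => ?_⟩
  have hf := hK.isCubeComplex.face (Function.Embedding.refl _) (fun i => !b₀ i) hcube
  have : (⟨c, hc⟩ : {c // K.IsCube n c}) = ⟨_, hf⟩ := by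
    refine Subtype.ext (funext fun b => hK.injective ?_)
    dsimp only
    rw [h.eq, hK.cube_eq]
    congr 2
    ext i
    have := faceCorner_apply (Function.Embedding.refl _) (fun i => !b₀ i) b i
    rw [Function.Embedding.refl_apply] at this
    simp only [Set.mem_ofPred_eq]
    rw [this]
    cases b i <;> cases b₀ i <;> simp
  rw [this]
  exact Quot.sound (Glue.face _ hcube _ _ hf t)

/-- If two points of cubes below vertices have the same function, and the first one is an interior
point, then the first cube is a face of the second one. -/
theorem point_eq_point {v w : V} {m n : ℕ} {D : Fin n → E} (hD : Function.Injective D)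
    (hv : ∀ i, D i ∈ S v) {D' : Fin m → E} (hD' : Function.Injective D') (hw : ∀ i, D' i ∈ S w)
    {t : Fin n → unitInterval} {t' : Fin m → unitInterval} (h0 : ∀ j, t' j ≠ 0)
    (h1 : ∀ j, t' j ≠ 1) (h : pointFun (S w) D' t' = pointFun (S v) D t) :
    hK.point w hD' hw t' = hK.point v hD hv t := by
  classical
  have happ : ∀ j, pointFun (S v) D t (D' j) = t' j := fun j => by
    rw [← h, pointFun_apply hD' hw]
  have hex : ∀ j, ∃ i, D i = D' j := by
    intro j
    have hj : D' j ∈ S v := by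
      by_contra hj
      exact h0 j (by rw [← happ, pointFun_of_notMem hj])
    by_contra hj'
    exact h1 j (by rw [← happ, pointFun_of_notMem_range hj hj'])
  choose e he using hex
  have he_inj : Function.Injective e := fun j₁ j₂ hj => hD' (by rw [← he, ← he, hj])
  have ht : ∀ j, t (e j) = t' j := fun j => by
    rw [← happ, ← he, pointFun_apply hD hv]
  have mem_w : ∀ x, x ∉ Set.range D' → (x ∈ S w ↔ pointFun (S v) D t x = 1) := by
    intro x hx
    rw [← h]
    by_cases hxw : x ∈ S w
    · simp [hxw, pointFun_of_notMem_range hxw hx]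
    · simp [hxw, pointFun_of_notMem hxw]
  have t_eq : ∀ i, (¬ ∃ j, e j = i) → D i ∉ Set.range D' := fun i hi ⟨j, hj⟩ =>
    hi ⟨j, hD ((he j).trans hj)⟩
  let e' : Fin m ↪ Fin n := ⟨e, he_inj⟩
  let b₁ : Fin n → Bool := fun i => decide (t i = 1)
  have hb₁ : ∀ j, b₁ (e j) = false := fun j => by simp [b₁, ht, h1]
  have hfp : facePoint e' b₁ t' = t := by
    funext i
    by_cases hi : ∃ j, e' j = i
    · obtain ⟨j, rfl⟩ := hi
      rw [facePoint_apply]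
      change (if b₁ (e j) then _ else _) = t (e j)
      rw [hb₁, ht]
      simp
    · rw [facePoint_of_notMem _ _ _ hi]
      by_cases hi1 : t i = 1
      · simp [b₁, hi1]
      · have hDi : D i ∉ S w := by
          rw [mem_w _ (t_eq i hi), pointFun_apply hD hv]
          exact hi1
        have : t i = 0 := by
          rw [← pointFun_apply (t := t) hD hv, ← h, pointFun_of_notMem hDi]
        simp [b₁, this]
  rw [hK.point_eq_point_facePoint hD hv hD' hw e' b₁ _ t', hfp]
  intro b
  have hcv := hK.isSetCube_cube v hD hv
  have hcw := hK.isSetCube_cube w hD' hw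
  apply hK.injective
  ext x
  by_cases hx : x ∈ Set.range D
  · obtain ⟨i, rfl⟩ := hx
    rw [hcv.mem_iff]
    by_cases hi : ∃ j, e' j = i
    · obtain ⟨j, rfl⟩ := hi
      rw [faceCorner_apply]
      change D (e j) ∈ _ ↔ xor (b₁ (e j)) _ = _
      rw [he, hcw.mem_iff, hb₁]
      simp
    · rw [faceCorner_of_notMem _ _ _ hi, hcw.mem_iff_of_notMem _ (t_eq i hi), hK.cube_true,
        mem_w _ (t_eq i hi), pointFun_apply hD hv]
      simp [b₁]
  · have hx' : x ∉ Set.range D' := fun ⟨j, hj⟩ => hx ⟨e j, (he j).trans hj⟩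
    rw [hcv.mem_iff_of_notMem _ hx, hcw.mem_iff_of_notMem _ hx', hK.cube_true, hK.cube_true,
      mem_w x hx']
    by_cases hxv : x ∈ S v
    · simp [hxv, pointFun_of_notMem_range hxv hx]
    · simp [hxv, pointFun_of_notMem hxv]

/-- Every point of a cube has the same function as an interior point of another cube. -/
theorem exists_interior (v : V) {n : ℕ} {D : Fin n → E} (hD : Function.Injective D)
    (hv : ∀ i, D i ∈ S v) (t : Fin n → unitInterval) : ∃ (w : V) (m : ℕ) (D' : Fin m → E)
    (_ : Function.Injective D') (_ : ∀ i, D' i ∈ S w) (t' : Fin m → unitInterval),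
    (∀ i, t' i ≠ 0) ∧ (∀ i, t' i ≠ 1) ∧ pointFun (S w) D' t' = pointFun (S v) D t := by
  classical
  let G : Finset (Fin n) := Finset.univ.filter fun i => t i ≠ 0 ∧ t i ≠ 1
  let e : Fin G.card ↪ Fin n := (G.orderEmbOfFin rfl).toEmbedding
  have he : ∀ i, (∃ j, e j = i) ↔ t i ≠ 0 ∧ t i ≠ 1 := by
    intro i
    have : i ∈ Set.range (G.orderEmbOfFin rfl) ↔ i ∈ (G : Set (Fin n)) := by
      rw [Finset.range_orderEmbOfFin]
    simp only [G, Finset.coe_filter, Finset.mem_univ, true_and, Set.mem_ofPred_eq] at this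
    exact this
  have he' : ∀ j, t (e j) ≠ 0 ∧ t (e j) ≠ 1 := fun j => (he _).1 ⟨j, rfl⟩
  obtain ⟨w, hw⟩ := hK.exists_diff v (D '' {i | t i = 0}) (Set.toFinite _)
  have mem_w : ∀ i, D i ∈ S w ↔ t i ≠ 0 := by
    intro i
    rw [hw, Set.mem_sdiff, hD.mem_set_image]
    simp [hv]
  have mem_w' : ∀ x, x ∉ Set.range D → (x ∈ S w ↔ x ∈ S v) := by
    intro x hx
    rw [hw, Set.mem_sdiff]
    exact ⟨fun h => h.1, fun h => ⟨h, fun ⟨i, _, hi⟩ => hx ⟨i, hi⟩⟩⟩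
  refine ⟨w, G.card, D ∘ e, hD.comp e.injective, fun j => (mem_w _).2 (he' j).1, t ∘ e,
    fun j => (he' j).1, fun j => (he' j).2, ?_⟩
  funext x
  by_cases hx : x ∈ Set.range D
  · obtain ⟨i, rfl⟩ := hx
    rw [pointFun_apply hD hv]
    by_cases hi : ∃ j, e j = i
    · obtain ⟨j, rfl⟩ := hi
      exact pointFun_apply (hD.comp e.injective) (fun j => (mem_w _).2 (he' j).1) j
    · have hi' : D i ∉ Set.range (D ∘ e) := fun ⟨j, hj⟩ => hi ⟨j, hD hj⟩
      by_cases h0 : t i = 0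
      · rw [pointFun_of_notMem (by rw [mem_w]; simpa using h0), h0]
      · rw [pointFun_of_notMem_range ((mem_w _).2 h0) hi']
        by_contra h1
        exact hi ((he i).2 ⟨h0, fun h => h1 h.symm⟩)
  · have hx' : x ∉ Set.range (D ∘ e) := fun ⟨j, hj⟩ => hx ⟨e j, hj⟩
    by_cases hxv : x ∈ S v
    · rw [pointFun_of_notMem_range hxv hx, pointFun_of_notMem_range ((mem_w' x hx).2 hxv) hx']
    · rw [pointFun_of_notMem hxv, pointFun_of_notMem (fun h => hxv ((mem_w' x hx).1 h))]

theorem realizationFun_injective : Function.Injective hK.realizationFun := by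
  intro x y hxy
  obtain ⟨⟨⟨n, c, hc⟩, t⟩, rfl⟩ := Quot.exists_rep x
  obtain ⟨⟨⟨n', c', hc'⟩, t'⟩, rfl⟩ := Quot.exists_rep y
  obtain ⟨v, D, hD, hv, φ, -, hs⟩ := hK.mk_eq_point hc
  obtain ⟨v', D', hD', hv', φ', -, hs'⟩ := hK.mk_eq_point hc'
  rw [hs t, hs' t'] at hxy ⊢
  rw [realizationFun_point, realizationFun_point] at hxy
  obtain ⟨w, m, D₁, hD₁, hw, t₁, h0, h1, h⟩ := hK.exists_interior v hD hv (φ t)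
  rw [← hK.point_eq_point hD hv hD₁ hw h0 h1 h,
    hK.point_eq_point hD' hv' hD₁ hw h0 h1 (h.trans hxy)]

/-- A deformation of functions on the ambient set that maps each cube into a cube induces a
deformation of the realization. -/
theorem exists_deformation (h : unitInterval → (E → unitInterval) → E → unitInterval)
    (hh : ∀ (v : V) {n : ℕ} (D : Fin n → E), Function.Injective D → (∀ i, D i ∈ S v) →
      ∃ (w : V) (F : Set E), F.Finite ∧ F ⊆ S w ∧
        (∀ s t, ∀ x ∉ S w, h s (pointFun (S v) D t) x = 0) ∧
        (∀ s t, ∀ x ∈ S w, x ∉ F → h s (pointFun (S v) D t) x = 1) ∧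
        ∀ x ∈ F, Continuous fun p : unitInterval × (Fin n → unitInterval) =>
          h p.1 (pointFun (S v) D p.2) x) :
    ∃ H : C(unitInterval × K.Realization, K.Realization),
      ∀ s x, hK.realizationFun (H (s, x)) = h s (hK.realizationFun x) := by
  have key : ∀ σ : K.Cube, ∃ q : C((Fin σ.1 → unitInterval) × unitInterval, K.Realization),
      ∀ t s, hK.realizationFun (q (t, s)) = h s (hK.realizationFun (Quot.mk _ ⟨σ, t⟩)) := by
    rintro ⟨n, c, hc⟩
    obtain ⟨v, D, hD, hv, φ, hφ, heq⟩ := hK.mk_eq_point hc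
    obtain ⟨w, F, hF, hFw, h0, h1, hcont⟩ := hh v D hD hv
    let D' : Fin hF.toFinset.card → E := fun i => hF.toFinset.equivFin.symm i
    have hD' : Function.Injective D' :=
      Subtype.val_injective.comp hF.toFinset.equivFin.symm.injective
    have hF' : ∀ i, D' i ∈ F := fun i => hF.mem_toFinset.1 (hF.toFinset.equivFin.symm i).2
    have hrange : ∀ x ∈ F, x ∈ Set.range D' := fun x hx =>
      ⟨hF.toFinset.equivFin ⟨x, hF.mem_toFinset.2 hx⟩, by simp [D']⟩
    refine ⟨⟨fun p => hK.point w hD' (fun i => hFw (hF' i))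
      (fun i => h p.2 (pointFun (S v) D (φ p.1)) (D' i)), ?_⟩, fun t s => ?_⟩
    · refine (hK.continuous_point w hD' _).comp (continuous_pi fun i => ?_)
      exact (hcont _ (hF' i)).comp (continuous_snd.prodMk (hφ.comp continuous_fst))
    · rw [heq, hK.realizationFun_point]
      refine (hK.realizationFun_point w hD' (fun i => hFw (hF' i)) _).trans
        (pointFun_comp hD' (fun i => hFw (hF' i)) (h0 s _) fun x hx hx' => ?_)
      exact h1 s _ x hx fun hxF => hx' (hrange x hxF)
  choose q hq using key
  let Q : C(K.Points, C(unitInterval, K.Realization)) :=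
    ⟨fun p => (q p.1).curry p.2, continuous_sigma fun σ => (q σ).curry.continuous⟩
  have hQ : ∀ p s, hK.realizationFun (Q p s) = h s (hK.realizationFun (Quot.mk _ p)) :=
    fun p s => hq p.1 p.2 s
  let R : C(K.Realization, C(unitInterval, K.Realization)) :=
    ⟨Quot.lift Q fun a b hab => ContinuousMap.ext fun s => hK.realizationFun_injective (by
      rw [hQ, hQ, Quot.sound hab]), continuous_quot_lift _ Q.continuous⟩
  refine ⟨R.uncurry.comp ContinuousMap.prodSwap, fun s x => ?_⟩
  obtain ⟨p, rfl⟩ := Quot.exists_rep x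
  exact hQ p s

theorem contractibleSpace [Nonempty V] : ContractibleSpace K.Realization := by
  classical
  obtain ⟨v₀⟩ := ‹Nonempty V›
  let A := S v₀
  let D₀ : Fin 0 → E := Fin.elim0
  have hD₀ : Function.Injective D₀ := fun i => i.elim0
  let x₀ := hK.point v₀ hD₀ (fun i => i.elim0) Fin.elim0
  have hx₀ : hK.realizationFun x₀ = fun x => if x ∈ A then 1 else 0 := by
    rw [hK.realizationFun_point]
    funext x
    by_cases hx : x ∈ A
    · rw [if_pos hx, pointFun_of_notMem_range hx (fun ⟨i, _⟩ => i.elim0)]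
    · rw [if_neg hx, pointFun_of_notMem hx]
  obtain ⟨H₁, hH₁⟩ := hK.exists_deformation
    (fun s f x => if x ∈ A then f x else unitInterval.symm s * f x) (by
    intro v n D hD hv
    refine ⟨v, Set.range D ∪ (S v \ A), (Set.finite_range D).union (hK.finite_diff v v₀),
      Set.union_subset (Set.range_subset_iff.2 hv) Set.sdiff_subset, ?_, ?_, ?_⟩
    · intro s t x hx
      simp [pointFun_of_notMem hx]
    · intro s t x hx hxF
      rw [Set.mem_union, not_or, Set.mem_sdiff, not_and, not_not] at hxF
      rw [if_pos (hxF.2 hx), pointFun_of_notMem_range hx hxF.1]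
    · intro x _
      have := continuous_pointFun (A := S v) hD x
      by_cases hx : x ∈ A
      · simp only [hx, if_true]
        fun_prop
      · simp only [hx, if_false]
        fun_prop)
  obtain ⟨H₂, hH₂⟩ := hK.exists_deformation
    (fun s f x => if x ∈ A then unitInterval.symm (unitInterval.symm s * unitInterval.symm (f x))
      else 0) (by
    intro v n D hD hv
    refine ⟨v₀, (Set.range D ∩ A) ∪ (A \ S v),
      ((Set.finite_range D).inter_of_left _).union (hK.finite_diff v₀ v),
      Set.union_subset Set.inter_subset_right Set.sdiff_subset, ?_, ?_, ?_⟩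
    · intro s t x hx
      exact if_neg hx
    · intro s t x hx hxF
      have hxA : x ∈ A := hx
      simp only [Set.mem_union, Set.mem_inter_iff, Set.mem_sdiff, hxA, and_true, true_and,
        not_or, not_not] at hxF
      rw [if_pos hxA, pointFun_of_notMem_range hxF.2 hxF.1]
      simp
    · intro x _
      have := continuous_pointFun (A := S v) hD x
      by_cases hx : x ∈ A
      · simp only [hx, if_true]
        fun_prop
      · simp only [hx, if_false]
        fun_prop)
  rw [contractible_iff_id_nullhomotopic]
  let r : C(K.Realization, K.Realization) :=
    ⟨fun x => H₁ (1, x), H₁.continuous.comp (by fun_prop)⟩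
  have h₁ : ContinuousMap.Homotopic (ContinuousMap.id K.Realization) r :=
    ⟨{ toContinuousMap := H₁
       map_zero_left := fun x => hK.realizationFun_injective (by
        change hK.realizationFun (H₁ (0, x)) = hK.realizationFun x
        rw [hH₁]; simp)
       map_one_left := fun x => rfl }⟩
  have h₂ : ContinuousMap.Homotopic r (ContinuousMap.const K.Realization x₀) :=
    ⟨{ toContinuousMap := H₂
       map_zero_left := fun x => hK.realizationFun_injective (by
        change hK.realizationFun (H₂ (0, x)) = hK.realizationFun (H₁ (1, x))
        rw [hH₁, hH₂]; simp)
       map_one_left := fun x => hK.realizationFun_injective (by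
        change hK.realizationFun (H₂ (1, x)) = hK.realizationFun x₀
        rw [hH₂, hx₀]; simp) }⟩
  exact ⟨x₀, h₁.trans h₂⟩

theorem isCAT0CubeComplex [Nonempty V] : K.IsCAT0CubeComplex where
  isCubeComplex := hK.isCubeComplex
  simplyConnected :=
    haveI := hK.contractibleSpace
    inferInstance
  flag := hK.isFlagLink

end IsSetModel

end CubeFamily

/-! ### Codimension and points -/

theorem coheight_irreducibleCloseds {X : Scheme.{u}} (W : IrreducibleCloseds X) (x : X)
    (h : (W : Set X) = closure {x}) : Order.coheight W = Order.coheight x := by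
  have : W = irreducibleSetEquivPoints.symm x := IrreducibleCloseds.ext h
  rw [this]
  exact Order.coheight_orderIso (irreducibleSetEquivPoints (α := X)).symm x

theorem lt_codim_iff {X : Scheme.{u}} {Z : Set X} (hZ : IsClosed Z) (l : ℕ) :
    (l : ℕ∞) < codim Z ↔ ∀ x ∈ Z, (l : ℕ∞) < Order.coheight x := by
  have key : (l : ℕ∞) < codim Z ↔
      ∀ W : IrreducibleCloseds X, (W : Set X) ⊆ Z → (l : ℕ∞) < Order.coheight W := by
    simp only [← ENat.add_one_le_iff (ENat.natCast_ne_top l), codim, le_iInf_iff]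
  rw [key]
  constructor
  · intro h x hx
    rw [← coheight_irreducibleCloseds
      ⟨closure {x}, isIrreducible_singleton.closure, isClosed_closure⟩ x rfl]
    exact h _ (closure_minimal (Set.singleton_subset_iff.2 hx) hZ)
  · intro h W hW
    rw [coheight_irreducibleCloseds W W.2.genericPoint (by
      rw [W.2.genericPoint_closure_eq]; exact W.isClosed.closure_eq.symm)]
    refine h _ (hW ?_)
    have := subset_closure (Set.mem_singleton W.2.genericPoint)
    rw [W.2.genericPoint_closure_eq] at this
    exact W.isClosed.closure_eq ▸ this

theorem codim_irreducibleCloseds {T : Type u} [TopologicalSpace T] (W : IrreducibleCloseds T) :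
    codim (W : Set T) = Order.coheight W :=
  le_antisymm (iInf₂_le W (Set.Subset.refl _))
    (le_iInf₂ fun W' h => Order.coheight_anti (a := W') (b := W) h)

/-! ### Composition of rational maps -/

namespace AlgebraicGeometry.Scheme

theorem Opens.ι_mem {X : Scheme.{u}} (U : X.Opens) (p : U.toScheme) : U.ι p ∈ U :=
  p.2

theorem Opens.exists_ι_eq {X : Scheme.{u}} (U : X.Opens) {x : X} (hx : x ∈ U) :
    ∃ p : U.toScheme, U.ι p = x :=
  ⟨⟨x, hx⟩, rfl⟩

theorem PartialMap.comp_toRationalMap_eq {X Y Z : Scheme.{u}} [PreirreducibleSpace X] [Nonempty Y]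
    (f : X.PartialMap Y) [IsDominant f.hom] (g : Y.PartialMap Z) (h : X.PartialMap Z)
    (W : X.Opens) (hW : Dense (W : Set X)) (hf : W ≤ f.domain) (hh : W ≤ h.domain)
    (a : W.toScheme ⟶ g.domain.toScheme) (ha : a ≫ g.domain.ι = X.homOfLE hf ≫ f.hom)
    (hag : a ≫ g.hom = X.homOfLE hh ≫ h.hom) :
    f.toRationalMap.comp g.toRationalMap = h.toRationalMap := by
  rw [RationalMap.toRationalMap_comp, PartialMap.toRationalMap_eq_iff]
  have hle : W ≤ f.domain.ι ''ᵁ f.hom ⁻¹ᵁ g.domain := by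
    intro x hx
    obtain ⟨p, rfl⟩ := W.exists_ι_eq hx
    refine ⟨X.homOfLE hf p, ?_, ?_⟩
    · change f.hom (X.homOfLE hf p) ∈ g.domain
      rw [← Hom.comp_apply, ← ha, Hom.comp_apply]
      exact g.domain.ι_mem _
    · rw [← X.homOfLE_ι hf, Hom.comp_apply]
      rfl
  have key : X.homOfLE hle ≫ (f.domain.ι.isoImage (f.hom ⁻¹ᵁ g.domain)).inv ≫
      f.hom ∣_ g.domain = a := by
    rw [← cancel_mono g.domain.ι, ha, Category.assoc, Category.assoc, morphismRestrict_ι,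
      ← Category.assoc, ← Category.assoc]
    congr 1
    rw [← cancel_mono f.domain.ι]
    simp
  refine ⟨W, hW, hle, hh, ?_⟩
  change X.homOfLE hle ≫ (f.domain.ι.isoImage (f.hom ⁻¹ᵁ g.domain)).inv ≫
    f.hom ∣_ g.domain ≫ g.hom = X.homOfLE hh ≫ h.hom
  rw [← hag, ← key]
  simp only [Category.assoc]

end AlgebraicGeometry.Scheme

namespace Variety

variable {k : Type u} [Field k]

instance (A : Variety k) : A.scheme.IsSeparated := by
  have : Limits.terminal.from A.scheme = A.str ≫ Limits.terminal.from _ := Subsingleton.elim _ _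
  exact ⟨this ▸ inferInstance⟩

instance (A : Variety k) : CompactSpace A.scheme := by
  exact (quasiCompact_iff_compactSpace A.str).1 inferInstance

instance (A : Variety k) : NoetherianSpace A.scheme :=
  haveI : IsNoetherian A.scheme := {}
  inferInstance

end Variety

/-- Local isomorphisms that are injective are open immersions. -/
theorem AlgebraicGeometry.IsLocalIso.isOpenImmersion_of_injective {X Y : Scheme.{u}} (f : X ⟶ Y)
    [IsLocalIso f] (hf : Function.Injective f) : IsOpenImmersion f := by
  have hopen : IsOpenMap f := by
    have : MorphismProperty.ContainsIdentities @UniversallyOpen := ⟨fun X => inferInstance⟩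
    have : UniversallyOpen f := IsLocalIso.le_of_isZariskiLocalAtSource @UniversallyOpen _ _ _ ‹_›
    exact f.isOpenMap
  have : ∀ x, IsIso (f.stalkMap x) := by
    intro x
    obtain ⟨U, hxU, hU⟩ := IsLocalIso.exists_isOpenImmersion (f := f) x
    obtain ⟨p, rfl⟩ := U.exists_ι_eq hxU
    have h1 := Scheme.Hom.stalkMap_comp U.ι f p
    have h2 : IsIso ((U.ι ≫ f).stalkMap p) := inferInstance
    rw [h1] at h2
    exact @IsIso.of_isIso_comp_right _ _ _ _ _ (f.stalkMap (U.ι p)) (U.ι.stalkMap p)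
      inferInstance h2
  exact .of_isIso_stalkMap f (.of_continuous_injective_isOpenMap f.continuous hf hopen)

namespace BirationalMap

open Scheme

variable {k : Type u} [Field k] {A B C D : Variety k}

theorem isDominant_of_toRationalMap_eq (f : BirationalMap A B) {g : A.scheme.PartialMap B.scheme}
    (hg : g.toRationalMap = f.hom) : IsDominant g.hom := by
  rw [← PartialMap.isDominant_toRationalMap_iff, hg]
  infer_instance

/-- A birational map is determined by its underlying rational map. -/
theorem ext_hom {f g : BirationalMap A B} (h : f.hom = g.hom) : f = g := by
  refine BirationalMap.ext h ?_
  have h1 : f.inv.comp (g.hom.comp g.inv) = (f.inv.comp f.hom).comp g.inv := by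
    rw [RationalMap.comp_assoc]
    simp only [h]
  simp only [g.hom_inv_id, f.inv_hom_id, RationalMap.id_comp, RationalMap.comp_id] at h1
  exact h1

/-- The identity. -/
noncomputable def refl (A : Variety k) : BirationalMap A A where
  hom := RationalMap.id A.scheme
  inv := RationalMap.id A.scheme
  hom_inv_id := RationalMap.comp_id _
  inv_hom_id := RationalMap.comp_id _

theorem trans_assoc (f : BirationalMap A B) (g : BirationalMap B C) (h : BirationalMap C D) :
    (f.trans g).trans h = f.trans (g.trans h) :=
  ext_hom (RationalMap.comp_assoc _ _ _)

theorem trans_symm (f : BirationalMap A B) : f.trans f.symm = refl A := ext_hom f.hom_inv_id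

theorem symm_trans (f : BirationalMap A B) : f.symm.trans f = refl B := ext_hom f.inv_hom_id

theorem refl_trans (f : BirationalMap A B) : (refl A).trans f = f := ext_hom (RationalMap.id_comp _)

theorem trans_refl (f : BirationalMap A B) : f.trans (refl B) = f := ext_hom (RationalMap.comp_id _)

/-- The birational map `f` is a local isomorphism at `x` that maps `x` to `y`. -/
def Rel (f : BirationalMap A B) (x : A.scheme) (y : B.scheme) : Prop :=
  ∃ g : A.scheme.PartialMap B.scheme, g.toRationalMap = f.hom ∧ IsOpenImmersion g.hom ∧
    ∃ p : g.domain.toScheme, g.domain.ι p = x ∧ g.hom p = y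

theorem notMem_exc_iff (f : BirationalMap A B) (x : A.scheme) : x ∉ f.exc ↔ ∃ y, f.Rel x y := by
  unfold exc
  rw [Set.mem_ofPred_eq, not_not]
  constructor
  · rintro ⟨g, hx, hg, hi⟩
    obtain ⟨p, hp⟩ := g.domain.exists_ι_eq hx
    exact ⟨_, g, hg, hi, p, hp, rfl⟩
  · rintro ⟨y, g, hg, hi, p, rfl, -⟩
    exact ⟨g, g.domain.ι_mem p, hg, hi⟩

theorem isClosed_exc (f : BirationalMap A B) : IsClosed f.exc := by
  rw [← isOpen_compl_iff, isOpen_iff_forall_mem_open]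
  intro x hx
  rw [Set.mem_compl_iff, exc, Set.mem_ofPred_eq, not_not] at hx
  obtain ⟨g, hx, hg, hi⟩ := hx
  refine ⟨g.domain, fun y hy => ?_, g.domain.2, hx⟩
  rw [Set.mem_compl_iff, exc, Set.mem_ofPred_eq, not_not]
  exact ⟨g, hy, hg, hi⟩

theorem Rel.functional {f : BirationalMap A B} {x : A.scheme} {y y' : B.scheme} (h : f.Rel x y)
    (h' : f.Rel x y') : y = y' := by
  obtain ⟨g, hg, hi, p, rfl, rfl⟩ := h
  obtain ⟨g', hg', hi', p', hp, rfl⟩ := h'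
  have he : g.equiv g' := PartialMap.toRationalMap_eq_iff.1 (hg.trans hg'.symm)
  rw [PartialMap.equiv_iff_of_isSeparated (S := Limits.terminal _)] at he
  have hx : g.domain.ι p ∈ g.domain ⊓ g'.domain :=
    ⟨g.domain.ι_mem p, hp ▸ g'.domain.ι_mem p'⟩
  obtain ⟨q, hq⟩ := (g.domain ⊓ g'.domain).exists_ι_eq hx
  have h1 : A.scheme.homOfLE inf_le_left q = p := by
    apply g.domain.ι.isOpenEmbedding.injective
    rw [← Hom.comp_apply, homOfLE_ι, hq]
  have h2 : A.scheme.homOfLE inf_le_right q = p' := by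
    apply g'.domain.ι.isOpenEmbedding.injective
    rw [← Hom.comp_apply, homOfLE_ι, hq, hp]
  rw [← h1, ← h2, ← Hom.comp_apply, ← Hom.comp_apply]
  exact congr($he q)

theorem Rel.symm {f : BirationalMap A B} {x : A.scheme} {y : B.scheme} (h : f.Rel x y) :
    f.symm.Rel y x := by
  obtain ⟨g, hg, hi, p, rfl, rfl⟩ := h
  have := f.isDominant_of_toRationalMap_eq hg
  let g' : B.scheme.PartialMap A.scheme :=
    ⟨g.hom.opensRange, g.hom.denseRange, g.hom.isoOpensRange.inv ≫ g.domain.ι⟩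
  have : IsDominant g'.hom := by
    have := Opens.isDominant_ι g.dense_domain
    exact inferInstanceAs (IsDominant (_ ≫ _))
  have key : g'.toRationalMap.comp g.toRationalMap = RationalMap.id B.scheme :=
    PartialMap.comp_toRationalMap_eq g' g _ g'.domain g'.dense_domain le_rfl le_top
      g.hom.isoOpensRange.inv (by simp [g']) (by
        rw [g.hom.isoOpensRange_inv_comp]
        change g.hom.opensRange.ι = B.scheme.homOfLE le_top ≫ (⊤ : B.scheme.Opens).ι ≫ 𝟙 _
        rw [Category.comp_id, homOfLE_ι])
  refine ⟨g', ?_, inferInstanceAs (IsOpenImmersion (_ ≫ _)), g.hom.isoOpensRange.hom p, ?_, ?_⟩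
  · have h1 : (g'.toRationalMap.comp f.hom).comp f.inv = g'.toRationalMap := by
      rw [RationalMap.comp_assoc, f.hom_inv_id, RationalMap.comp_id]
    simp only [← hg, key, RationalMap.id_comp] at h1
    exact h1.symm
  · change (g.hom.isoOpensRange.hom ≫ g.hom.opensRange.ι) p = _
    rw [g.hom.isoOpensRange_hom_ι]
  · change (g.hom.isoOpensRange.hom ≫ g.hom.isoOpensRange.inv ≫ g.domain.ι) p = _
    rw [Iso.hom_inv_id_assoc]

theorem Rel.trans {f : BirationalMap A B} {g : BirationalMap B C} {x : A.scheme} {y : B.scheme}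
    {z : C.scheme} (h : f.Rel x y) (h' : g.Rel y z) : (f.trans g).Rel x z := by
  obtain ⟨p, hp, hi, a, rfl, rfl⟩ := h
  obtain ⟨q, hq, hi', b, hb, rfl⟩ := h'
  have := f.isDominant_of_toRationalMap_eq hp
  let s := p.hom ⁻¹ᵁ q.domain
  have ha : a ∈ s := by
    change p.hom a ∈ q.domain
    rw [← hb]
    exact q.domain.ι_mem b
  obtain ⟨a', rfl⟩ := s.exists_ι_eq ha
  have hb' : (p.hom ∣_ q.domain) a' = b := by
    apply q.domain.ι.isOpenEmbedding.injective
    rw [hb, ← Hom.comp_apply, morphismRestrict_ι, Hom.comp_apply]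
  refine ⟨p.comp q, ?_, ?_, (p.domain.ι.isoImage s).hom a', ?_, ?_⟩
  · rw [← RationalMap.toRationalMap_comp]
    simp only [hp, hq]
    rfl
  · exact inferInstanceAs
      (IsOpenImmersion ((p.domain.ι.isoImage s).inv ≫ p.hom ∣_ q.domain ≫ q.hom))
  · change ((p.domain.ι.isoImage s).hom ≫ (p.domain.ι ''ᵁ s).ι) a' = _
    simp
  · change ((p.domain.ι.isoImage s).hom ≫
      (p.domain.ι.isoImage s).inv ≫ p.hom ∣_ q.domain ≫ q.hom) a' = _
    rw [Iso.hom_inv_id_assoc, Hom.comp_apply, hb']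

theorem rel_symm_iff {f : BirationalMap A B} {x : A.scheme} {y : B.scheme} :
    f.symm.Rel y x ↔ f.Rel x y := ⟨Rel.symm, Rel.symm⟩

theorem Rel.coheight_eq {f : BirationalMap A B} {x : A.scheme} {y : B.scheme} (h : f.Rel x y) :
    Order.coheight y = Order.coheight x := by
  obtain ⟨g, hg, hi, p, rfl, rfl⟩ := h
  exact (coheight_eq_of_isOpenImmersion g.hom).trans
    (coheight_eq_of_isOpenImmersion g.domain.ι).symm

theorem isIsoInCodim_iff (f : BirationalMap A B) (l : ℕ) : f.IsIsoInCodim l ↔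
    (∀ x, Order.coheight x ≤ l → ∃ y, f.Rel x y) ∧
      ∀ y, Order.coheight y ≤ l → ∃ x, f.Rel x y := by
  unfold IsIsoInCodim
  rw [lt_codim_iff f.isClosed_exc, lt_codim_iff f.symm.isClosed_exc]
  refine and_congr (forall_congr' fun x => ?_) (forall_congr' fun y => ?_)
  · rw [← notMem_exc_iff, ← not_lt]; tauto
  · simp only [← rel_symm_iff (f := f)]
    rw [← notMem_exc_iff, ← not_lt]; tauto

theorem rel_ofOpen (A : Variety k) (U : A.scheme.Opens) (hU : (U : Set A.scheme).Nonempty)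
    (p : U.toScheme) : (ofOpen A U hU).Rel p (U.ι p) := by
  let i : (A.openSubvariety U hU).scheme ⟶ A.scheme := U.ι
  have : IsOpenImmersion i := inferInstanceAs (IsOpenImmersion U.ι)
  have hi : IsOpenImmersion i.toPartialMap.hom :=
    inferInstanceAs (IsOpenImmersion ((A.openSubvariety U hU).scheme.topIso.hom ≫ i))
  obtain ⟨q, hq⟩ := (⊤ : (A.openSubvariety U hU).scheme.Opens).exists_ι_eq (x := p) trivial
  refine ⟨i.toPartialMap, rfl, hi, q, hq, ?_⟩
  change ((⊤ : (A.openSubvariety U hU).scheme.Opens).ι ≫ i) q = i p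
  rw [Hom.comp_apply, hq]

/-- An open immersion of varieties, as a birational map. -/
noncomputable def ofOpenImmersion (i : A.scheme ⟶ B.scheme) [IsOpenImmersion i]
    (hi : i ≫ B.str = A.str) : BirationalMap A B :=
  letI p : B.scheme.PartialMap A.scheme :=
    ⟨i.opensRange, i.opensRange.2.dense (Set.range_nonempty i), i.isoOpensRange.inv⟩
  haveI : IsDominant i := ⟨p.dense_domain⟩
  haveI : IsDominant p.hom := inferInstanceAs (IsDominant i.isoOpensRange.inv)
  haveI : i.IsOver (Spec (.of k)) := ⟨hi⟩
  haveI : p.IsOver (Spec (.of k)) := ⟨by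
    change i.isoOpensRange.inv ≫ A.str = i.opensRange.ι ≫ B.str
    rw [← hi, i.isoOpensRange_inv_comp_assoc]⟩
  have key : p.toRationalMap.comp i.toRationalMap = RationalMap.id B.scheme :=
    PartialMap.comp_toRationalMap_eq p i.toPartialMap _ p.domain p.dense_domain le_rfl le_top
      (i.isoOpensRange.inv ≫ A.scheme.topIso.inv) (by
        change (i.isoOpensRange.inv ≫ A.scheme.topIso.inv) ≫ (⊤ : A.scheme.Opens).ι =
          B.scheme.homOfLE le_rfl ≫ i.isoOpensRange.inv
        simp) (by
        change (i.isoOpensRange.inv ≫ A.scheme.topIso.inv) ≫ A.scheme.topIso.hom ≫ i =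
          B.scheme.homOfLE le_top ≫ (⊤ : B.scheme.Opens).ι ≫ 𝟙 _
        simp)
  { hom := i.toRationalMap
    inv := p.toRationalMap
    hom_inv_id := by
      apply rationalMap_eq_of_compHom_eq i
      rw [← RationalMap.comp_toRationalMap, RationalMap.comp_assoc]
      simp only [key, RationalMap.comp_id, RationalMap.id_compHom]
    inv_hom_id := key }

theorem rel_of_hom_eq (f : BirationalMap A B) (i : A.scheme ⟶ B.scheme) [IsOpenImmersion i]
    (h : f.hom = i.toRationalMap) (x : A.scheme) : f.Rel x (i x) := by
  have hi : IsOpenImmersion i.toPartialMap.hom :=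
    inferInstanceAs (IsOpenImmersion (A.scheme.topIso.hom ≫ i))
  obtain ⟨q, hq⟩ := (⊤ : A.scheme.Opens).exists_ι_eq (x := x) trivial
  refine ⟨i.toPartialMap, h.symm, hi, q, hq, ?_⟩
  change ((⊤ : A.scheme.Opens).ι ≫ i) q = i x
  rw [Hom.comp_apply, hq]

/-- The locus where `f` is a local isomorphism. -/
def isoLocus (f : BirationalMap A B) : A.scheme.Opens := ⟨f.excᶜ, f.isClosed_exc.isOpen_compl⟩

theorem mem_isoLocus {f : BirationalMap A B} {x : A.scheme} : x ∈ f.isoLocus ↔ ∃ y, f.Rel x y :=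
  f.notMem_exc_iff x

theorem isoLocus_le_domain (f : BirationalMap A B) : f.isoLocus ≤ f.hom.toPartialMap.domain := by
  intro x hx
  obtain ⟨y, g, hg, hi, p, rfl, rfl⟩ := mem_isoLocus.1 hx
  exact RationalMap.mem_domain.2 ⟨g, g.domain.ι_mem p, hg⟩

/-- A birational map on the locus where it is a local isomorphism. -/
noncomputable def isoLocusHom (f : BirationalMap A B) : f.isoLocus.toScheme ⟶ B.scheme :=
  A.scheme.homOfLE f.isoLocus_le_domain ≫ f.hom.toPartialMap.hom

theorem homOfLE_isoLocusHom (f : BirationalMap A B) (g : A.scheme.PartialMap B.scheme)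
    (hg : g.toRationalMap = f.hom) (hle : g.domain ≤ f.isoLocus) :
    A.scheme.homOfLE hle ≫ f.isoLocusHom = g.hom := by
  have key : ∀ (F : A.scheme ⤏ B.scheme) (_ : g.toRationalMap = F)
      (h : g.domain ≤ F.toPartialMap.domain),
      A.scheme.homOfLE h ≫ F.toPartialMap.hom = g.hom := by
    rintro _ rfl h
    exact g.toPartialMap_toRationalMap_restrict
  rw [isoLocusHom, homOfLE_homOfLE_assoc]
  exact key f.hom hg _

theorem rel_isoLocusHom (f : BirationalMap A B) (p : f.isoLocus.toScheme) :
    f.Rel (f.isoLocus.ι p) (f.isoLocusHom p) := by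
  obtain ⟨y, g, hg, hi, q, hq, rfl⟩ := mem_isoLocus.1 (f.isoLocus.ι_mem p)
  have hle : g.domain ≤ f.isoLocus := fun x hx => by
    obtain ⟨r, rfl⟩ := g.domain.exists_ι_eq hx
    exact mem_isoLocus.2 ⟨_, g, hg, hi, r, rfl, rfl⟩
  refine ⟨g, hg, hi, q, hq, ?_⟩
  rw [← f.homOfLE_isoLocusHom g hg hle, Hom.comp_apply]
  congr 1
  apply f.isoLocus.ι.isOpenEmbedding.injective
  rw [← Hom.comp_apply, homOfLE_ι, hq]

instance (f : BirationalMap A B) : IsOpenImmersion f.isoLocusHom := by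
  have : IsLocalIso f.isoLocusHom := by
    refine ⟨fun p => ?_⟩
    obtain ⟨y, g, hg, hi, q, hq, rfl⟩ := mem_isoLocus.1 (f.isoLocus.ι_mem p)
    have hle : g.domain ≤ f.isoLocus := fun x hx => by
      obtain ⟨r, rfl⟩ := g.domain.exists_ι_eq hx
      exact mem_isoLocus.2 ⟨_, g, hg, hi, r, rfl, rfl⟩
    refine ⟨(A.scheme.homOfLE hle).opensRange, ⟨q, ?_⟩, ?_⟩
    · apply f.isoLocus.ι.isOpenEmbedding.injective
      exact (congr($(A.scheme.homOfLE_ι hle) q)).trans hq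
    · have : (A.scheme.homOfLE hle).opensRange.ι ≫ f.isoLocusHom =
          (A.scheme.homOfLE hle).isoOpensRange.inv ≫ g.hom := by
        rw [← f.homOfLE_isoLocusHom g hg hle, Hom.isoOpensRange_inv_comp_assoc]
      rw [this]
      infer_instance
  refine IsLocalIso.isOpenImmersion_of_injective _ fun p q hpq => ?_
  have hp := f.rel_isoLocusHom p
  rw [hpq] at hp
  exact f.isoLocus.ι.isOpenEmbedding.injective (hp.symm.functional (f.rel_isoLocusHom q).symm)

theorem toRationalMap_isoLocusHom (f : BirationalMap A B) (h : Dense (f.isoLocus : Set A.scheme)) :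
    (⟨f.isoLocus, h, f.isoLocusHom⟩ : A.scheme.PartialMap B.scheme).toRationalMap = f.hom :=
  (PartialMap.restrict_toRationalMap f.hom.toPartialMap _ h f.isoLocus_le_domain).trans
    f.hom.toRationalMap_toPartialMap

theorem rel_restrict_iff (φ : BirationalMap A B) (U : A.scheme.Opens)
    (hU : (U : Set A.scheme).Nonempty) (p : U.toScheme) (y : B.scheme) :
    (φ.restrict U hU).Rel p y ↔ φ.Rel (U.ι p) y := by
  have h := rel_ofOpen A U hU p
  refine ⟨fun h' => ?_, fun h' => h.trans h'⟩
  have := h.symm.trans h'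
  rwa [restrict, ← trans_assoc, symm_trans, refl_trans] at this

end BirationalMap

/-! ### Gluing along open immersions -/

namespace AlgebraicGeometry

open Limits Scheme

/-- Two schemes can be glued along an open subscheme of both. -/
theorem exists_isPushout {W A B : Scheme.{u}} (a : W ⟶ A) (b : W ⟶ B) [IsOpenImmersion a]
    [IsOpenImmersion b] : ∃ (G : Scheme.{u}) (i : A ⟶ G) (j : B ⟶ G), IsPushout a b i j ∧
      IsOpenImmersion i ∧ IsOpenImmersion j ∧ (∀ g, (∃ x, i x = g) ∨ ∃ y, j y = g) ∧
      ∀ x y, i x = j y → ∃ w, a w = x ∧ b w = y := by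
  let F := span a b
  have hF : ∀ {i j : WalkingSpan} (f : i ⟶ j), IsOpenImmersion (F.map f) := by
    rintro _ _ (_ | (_ | _))
    · exact inferInstanceAs (IsOpenImmersion (𝟙 _))
    · assumption
    · assumption
  have : Small.{u} WalkingSpan := inferInstance
  have hloc : (F ⋙ Scheme.forget).IsLocallyDirected := inferInstance
  have hthin : Quiver.IsThin WalkingSpan := inferInstance
  have hι : ∀ k, IsOpenImmersion (colimit.ι F k) := fun k => inferInstance
  refine ⟨colimit F, colimit.ι F .left, colimit.ι F .right, ?_, hι _, hι _,
    fun g => ?_, fun x y hxy => ?_⟩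
  · exact IsPushout.of_hasPushout a b
  · obtain ⟨(_ | _ | _), x, hx⟩ := IsLocallyDirected.ι_jointly_surjective F g
    · exact Or.inl ⟨a x, by
        rw [← hx, ← colimit.w F WalkingSpan.Hom.fst, Hom.comp_apply]
        rfl⟩
    · exact Or.inl ⟨x, hx⟩
    · exact Or.inr ⟨x, hx⟩
  · obtain ⟨k, f, g, z, hf, hg⟩ := (IsLocallyDirected.ι_eq_ι_iff F).1 hxy
    rcases k with (_ | _ | _)
    · obtain rfl : f = WalkingSpan.Hom.fst := Subsingleton.elim _ _
      obtain rfl : g = WalkingSpan.Hom.snd := Subsingleton.elim _ _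
      exact ⟨z, hf, hg⟩
    · change WidePushoutShape.Hom _ _ at g
      nomatch g
    · change WidePushoutShape.Hom _ _ at f
      nomatch f

theorem exists_lift_of_closedPoint {R : Type u} [CommRing R] [IsLocalRing R] {A G : Scheme.{u}}
    (l : Spec (.of R) ⟶ G) (i : A ⟶ G) [IsOpenImmersion i] (z : Spec (.of R))
    (hz : z = IsLocalRing.closedPoint R) (h : ∃ x, i x = l z) : ∃ l', l' ≫ i = l := by
  subst hz
  have h1 : l ⁻¹ᵁ i.opensRange = ⊤ := preimage_eq_top_of_closedPoint_mem l h
  refine ⟨IsOpenImmersion.lift i l ?_, IsOpenImmersion.lift_fac _ _ _⟩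
  rintro _ ⟨x, rfl⟩
  have : x ∈ l ⁻¹ᵁ i.opensRange := h1 ▸ trivial
  exact this

/-- A criterion for a morphism to be separated in terms of morphisms from neighbourhoods of pairs of
points to separated schemes. -/
theorem IsSeparated.of_forall_exists {G S : Scheme.{u}} (s : G ⟶ S) [QuasiSeparated s]
    (h : ∀ x y : G, ∃ (U V C : Scheme.{u}) (i : U ⟶ G) (j : V ⟶ G) (c : C ⟶ S) (p : U ⟶ C)
      (q : V ⟶ C), IsOpenImmersion i ∧ IsOpenImmersion j ∧ IsSeparated c ∧ IsSeparated (i ≫ s) ∧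
      (∃ u, i u = x) ∧ (∃ v, j v = y) ∧ p ≫ c = i ≫ s ∧ q ≫ c = j ≫ s ∧
      (∀ (T : Scheme.{u}) (a : T ⟶ U) (b : T ⟶ V), a ≫ i = b ≫ j → a ≫ p = b ≫ q) ∧
      ∀ u v, p u = q v → i u = j v) : IsSeparated s := by
  refine IsSeparated.of_valuativeCriterion s fun Q => ⟨?_⟩
  rintro ⟨l₁, h₁, h₁'⟩ ⟨l₂, h₂, h₂'⟩
  ext : 1
  dsimp only at *
  obtain ⟨z, hz⟩ : ∃ z : Spec (.of Q.R), z = IsLocalRing.closedPoint Q.R := ⟨_, rfl⟩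
  obtain ⟨U, V, C, i, j, c, p, q, hi, hj, hc, his, hx, hy, hp, hq, hT, hpt⟩ := h (l₁ z) (l₂ z)
  have unique : ∀ {Y : Scheme.{u}} (t : Y ⟶ S) [IsSeparated t] (m₁ m₂ : Spec (.of Q.R) ⟶ Y),
      Spec.map (CommRingCat.ofHom (algebraMap Q.R Q.K)) ≫ m₁ =
        Spec.map (CommRingCat.ofHom (algebraMap Q.R Q.K)) ≫ m₂ → m₁ ≫ t = Q.i₂ → m₂ ≫ t = Q.i₂ →
      m₁ = m₂ := by
    intro Y t ht m₁ m₂ h h1 h2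
    let Q' : ValuativeCommSq t :=
      { R := Q.R, K := Q.K
        i₁ := Spec.map (CommRingCat.ofHom (algebraMap Q.R Q.K)) ≫ m₁
        i₂ := Q.i₂
        commSq := ⟨by rw [Category.assoc, h1]⟩ }
    have := IsSeparated.valuativeCriterion t Q'
    let L₁ : Q'.commSq.LiftStruct := ⟨m₁, rfl, h1⟩
    let L₂ : Q'.commSq.LiftStruct := ⟨m₂, h.symm, h2⟩
    exact congrArg CommSq.LiftStruct.l (Subsingleton.elim L₁ L₂)
  obtain ⟨m₁, rfl⟩ := exists_lift_of_closedPoint l₁ i z hz hx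
  obtain ⟨m₂, hm₂⟩ := exists_lift_of_closedPoint l₂ j z hz hy
  have hpq : m₁ ≫ p = m₂ ≫ q := by
    refine unique c _ _ ?_ ?_ ?_
    · rw [← Category.assoc, ← Category.assoc]
      apply hT
      rw [Category.assoc, Category.assoc, h₁, hm₂, h₂]
    · rw [Category.assoc, hp, ← Category.assoc, h₁']
    · rw [Category.assoc, hq, ← Category.assoc, hm₂, h₂']
  have hpt' := hpt (m₁ z) (m₂ z) (by
    rw [← Hom.comp_apply, hpq, Hom.comp_apply])
  obtain ⟨m₃, rfl⟩ := exists_lift_of_closedPoint l₂ i z hz ⟨_, hpt'.trans (by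
    rw [← hm₂, Hom.comp_apply])⟩
  congr 1
  refine unique (i ≫ s) _ _ ?_ ?_ ?_
  · rw [← cancel_mono i, Category.assoc, Category.assoc, h₁, h₂]
  · rw [← Category.assoc, h₁']
  · rw [← Category.assoc, h₂']

/-- A property that is local at the source can be checked on two open subschemes. -/
theorem IsZariskiLocalAtSource.of_openImmersions (P : MorphismProperty Scheme.{u})
    [IsZariskiLocalAtSource P] {A B G S : Scheme.{u}} (i : A ⟶ G) (j : B ⟶ G) [IsOpenImmersion i]
    [IsOpenImmersion j] (h : ∀ g, (∃ x, i x = g) ∨ ∃ y, j y = g) (s : G ⟶ S) (hi : P (i ≫ s))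
    (hj : P (j ≫ s)) : P s := by
  refine IsZariskiLocalAtSource.of_iSup_eq_top
    (fun b : Bool => if b then i.opensRange else j.opensRange) ?_ ?_
  · rw [eq_top_iff]
    intro g _
    rw [Opens.mem_iSup]
    rcases h g with ⟨x, hx⟩ | ⟨x, hx⟩
    · exact ⟨true, x, hx⟩
    · exact ⟨false, x, hx⟩
  · rintro (_ | _)
    · change P (j.opensRange.ι ≫ s)
      rw [← j.isoOpensRange_inv_comp, Category.assoc]
      exact IsZariskiLocalAtSource.comp hj _
    · change P (i.opensRange.ι ≫ s)
      rw [← i.isoOpensRange_inv_comp, Category.assoc]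
      exact IsZariskiLocalAtSource.comp hi _

/-- A scheme that is covered by two integral open subschemes that meet is integral. -/
theorem isIntegral_of_openImmersions {A B G : Scheme.{u}} (i : A ⟶ G) (j : B ⟶ G)
    [IsOpenImmersion i] [IsOpenImmersion j] [IsIntegral A] [IsIntegral B]
    (h : ∀ g, (∃ x, i x = g) ∨ ∃ y, j y = g) {a : A} {b : B} (hab : i a = j b) :
    IsIntegral G := by
  have hred : IsReduced G := by
    have : ∀ g : G, _root_.IsReduced (G.presheaf.stalk g) := by
      intro g
      rcases h g with ⟨x, rfl⟩ | ⟨x, rfl⟩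
      · exact isReduced_of_injective (i.stalkMap x).hom
          (ConcreteCategory.bijective_of_isIso (i.stalkMap x)).1
      · exact isReduced_of_injective (j.stalkMap x).hom
          (ConcreteCategory.bijective_of_isIso (j.stalkMap x)).1
    exact isReduced_of_isReduced_stalk G
  have hdense : closure (Set.range i) = Set.univ := by
    rw [← dense_iff_closure_eq, dense_iff_inter_open]
    rintro O hO ⟨g, hg⟩
    rcases h g with ⟨x, rfl⟩ | ⟨y, rfl⟩
    · exact ⟨_, hg, x, rfl⟩
    · have h1 : IsOpen (j ⁻¹' O) := hO.preimage j.continuous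
      have h2 : IsOpen (j ⁻¹' Set.range i) := i.isOpenEmbedding.isOpen_range.preimage j.continuous
      obtain ⟨z, hz, x, hx⟩ := nonempty_preirreducible_inter h1 h2 ⟨y, hg⟩ ⟨b, a, hab⟩
      exact ⟨_, hz, x, hx⟩
  have hirr : IsIrreducible (Set.univ : Set G) := by
    rw [← hdense, ← Set.image_univ]
    exact ((IrreducibleSpace.isIrreducible_univ A).image i i.continuous.continuousOn).closure
  have : IrreducibleSpace G := (irreducibleSpace_def G).2 hirr
  exact isIntegral_of_irreducibleSpace_of_isReduced G

end AlgebraicGeometry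

namespace BirationalMap

open Scheme Limits

variable {k : Type u} [Field k] {A B C D : Variety k}

theorem isoLocusHom_str (f : BirationalMap A B) :
    f.isoLocusHom ≫ B.str = f.isoLocus.ι ≫ A.str := by
  have h : f.hom.toPartialMap.hom ≫ B.str = f.hom.toPartialMap.domain.ι ≫ A.str :=
    (inferInstance : f.hom.toPartialMap.IsOver (Spec (.of k))).1
  rw [isoLocusHom, Category.assoc, h, homOfLE_ι_assoc]

/-- The restrictions of `f`, `g` and their composition to the loci where they are local
isomorphisms are compatible. -/
theorem isoLocusHom_trans (f : BirationalMap A B) (g : BirationalMap B C) {T : Scheme.{u}}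
    (hf : Dense (f.isoLocus : Set A.scheme)) (hg : Dense (g.isoLocus : Set B.scheme))
    (hfg : Dense ((f.trans g).isoLocus : Set A.scheme))
    (a : T ⟶ f.isoLocus.toScheme) (b : T ⟶ g.isoLocus.toScheme)
    (c : T ⟶ (f.trans g).isoLocus.toScheme) (hab : a ≫ f.isoLocusHom = b ≫ g.isoLocus.ι)
    (hac : a ≫ f.isoLocus.ι = c ≫ (f.trans g).isoLocus.ι) :
    b ≫ g.isoLocusHom = c ≫ (f.trans g).isoLocusHom := by
  let P : A.scheme.PartialMap B.scheme := ⟨f.isoLocus, hf, f.isoLocusHom⟩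
  let Q : B.scheme.PartialMap C.scheme := ⟨g.isoLocus, hg, g.isoLocusHom⟩
  let R : A.scheme.PartialMap C.scheme := ⟨(f.trans g).isoLocus, hfg, (f.trans g).isoLocusHom⟩
  have hP : P.toRationalMap = f.hom := f.toRationalMap_isoLocusHom hf
  have hQ : Q.toRationalMap = g.hom := g.toRationalMap_isoLocusHom hg
  have := f.isDominant_of_toRationalMap_eq hP
  have he : (P.comp Q).equiv R := by
    rw [← PartialMap.toRationalMap_eq_iff, ← RationalMap.toRationalMap_comp]
    simp only [hP, hQ]
    exact ((f.trans g).toRationalMap_isoLocusHom hfg).symm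
  rw [PartialMap.equiv_iff_of_isSeparated (S := Limits.terminal _)] at he
  let E := f.isoLocus.ι ''ᵁ f.isoLocusHom ⁻¹ᵁ g.isoLocus
  let e : E.toScheme ⟶ (f.isoLocusHom ⁻¹ᵁ g.isoLocus).toScheme :=
    (f.isoLocus.ι.isoImage (f.isoLocusHom ⁻¹ᵁ g.isoLocus)).inv
  have hE : e ≫ (f.isoLocusHom ⁻¹ᵁ g.isoLocus).ι ≫ f.isoLocus.ι = E.ι :=
    Hom.isoImage_inv_ι _ _
  change A.scheme.homOfLE (inf_le_left : E ⊓ (f.trans g).isoLocus ≤ E) ≫ e ≫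
    f.isoLocusHom ∣_ g.isoLocus ≫ g.isoLocusHom = A.scheme.homOfLE
      (inf_le_right : E ⊓ (f.trans g).isoLocus ≤ _) ≫ (f.trans g).isoLocusHom at he
  have hle : ∀ t, (a ≫ f.isoLocus.ι) t ∈ E ⊓ (f.trans g).isoLocus := by
    intro t
    refine ⟨⟨a t, ?_, rfl⟩, ?_⟩
    · change (a ≫ f.isoLocusHom) t ∈ g.isoLocus
      rw [hab]
      exact g.isoLocus.ι_mem (b t)
    · rw [hac]
      exact (f.trans g).isoLocus.ι_mem (c t)
  let t : T ⟶ (E ⊓ (f.trans g).isoLocus).toScheme :=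
    IsOpenImmersion.lift (E ⊓ (f.trans g).isoLocus).ι (a ≫ f.isoLocus.ι) (by
      rintro _ ⟨x, rfl⟩
      rw [Opens.range_ι]
      exact hle x)
  have ht : t ≫ (E ⊓ (f.trans g).isoLocus).ι = a ≫ f.isoLocus.ι := IsOpenImmersion.lift_fac _ _ _
  have hc : t ≫ A.scheme.homOfLE inf_le_right = c := by
    rw [← cancel_mono (f.trans g).isoLocus.ι, ← hac, ← ht, Category.assoc]
    congr 1
    exact homOfLE_ι _ _
  have ha : t ≫ A.scheme.homOfLE inf_le_left ≫ e ≫ (f.isoLocusHom ⁻¹ᵁ g.isoLocus).ι = a := by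
    rw [← cancel_mono f.isoLocus.ι, ← ht]
    simp only [Category.assoc, hE, homOfLE_ι]
  have hb : t ≫ A.scheme.homOfLE inf_le_left ≫ e ≫ f.isoLocusHom ∣_ g.isoLocus = b := by
    rw [← cancel_mono g.isoLocus.ι, ← hab, ← ha]
    simp only [Category.assoc, morphismRestrict_ι]
  rw [← hc, ← hb]
  simpa only [Category.assoc] using congr(t ≫ $he)

/-- Two varieties can be glued along the locus where a birational map is an isomorphism, if any two
points of them have neighbourhoods that embed into a common variety. -/
theorem exists_glue (f : BirationalMap A B) (hne : (f.isoLocus : Set A.scheme).Nonempty)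
    (h : ∀ a b, ∃ (C : Variety k) (h : BirationalMap B C), (∃ c, (f.trans h).Rel a c) ∧
      ∃ c, h.Rel b c) :
    ∃ (G : Variety k) (φ : BirationalMap A G) (ψ : BirationalMap B G),
      (∀ a, ∃ g, φ.Rel a g) ∧ (∀ b, ∃ g, ψ.Rel b g) ∧
      (∀ g, (∃ a, φ.Rel a g) ∨ ∃ b, ψ.Rel b g) ∧ φ = f.trans ψ := by
  obtain ⟨G, i, j, hij, hi, hj, hcov, hpt⟩ := exists_isPushout f.isoLocus.ι f.isoLocusHom
  have hfd : Dense (f.isoLocus : Set A.scheme) := f.isoLocus.2.dense hne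
  let s : G ⟶ Spec (.of k) := hij.desc A.str B.str f.isoLocusHom_str.symm
  have his : i ≫ s = A.str := hij.inl_desc _ _ _
  have hjs : j ≫ s = B.str := hij.inr_desc _ _ _
  have key : ∀ a b, ∃ (U V C : Scheme.{u}) (i' : U ⟶ G) (j' : V ⟶ G) (c : C ⟶ Spec (.of k))
      (p : U ⟶ C) (q : V ⟶ C), IsOpenImmersion i' ∧ IsOpenImmersion j' ∧ IsSeparated c ∧
      IsSeparated (i' ≫ s) ∧ IsSeparated (j' ≫ s) ∧
      (∃ u, i' u = i a) ∧ (∃ v, j' v = j b) ∧ p ≫ c = i' ≫ s ∧ q ≫ c = j' ≫ s ∧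
      (∀ (T : Scheme.{u}) (a : T ⟶ U) (b : T ⟶ V), a ≫ i' = b ≫ j' → a ≫ p = b ≫ q) ∧
      ∀ u v, p u = q v → i' u = j' v := by
    intro a b
    obtain ⟨C, h, ha, hb⟩ := h a b
    have ha' := mem_isoLocus.2 ha
    have hb' := mem_isoLocus.2 hb
    have hd := h.isoLocus.2.dense ⟨b, hb'⟩
    have hfhd := (f.trans h).isoLocus.2.dense ⟨a, ha'⟩
    refine ⟨_, _, C.scheme, (f.trans h).isoLocus.ι ≫ i, h.isoLocus.ι ≫ j, C.str,
      (f.trans h).isoLocusHom, h.isoLocusHom, inferInstance, inferInstance, inferInstance, ?_, ?_,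
      ?_, ?_, ?_, ?_, ?_, ?_⟩
    · rw [Category.assoc, his]
      infer_instance
    · rw [Category.assoc, hjs]
      infer_instance
    · obtain ⟨p, rfl⟩ := Opens.exists_ι_eq _ ha'
      exact ⟨p, Hom.comp_apply _ _ _⟩
    · obtain ⟨p, rfl⟩ := Opens.exists_ι_eq _ hb'
      exact ⟨p, Hom.comp_apply _ _ _⟩
    · rw [Category.assoc, his, isoLocusHom_str]
    · rw [Category.assoc, hjs, isoLocusHom_str]
    · intro T a' b' e
      rw [← Category.assoc, ← Category.assoc] at e
      let w : T ⟶ f.isoLocus.toScheme :=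
        IsOpenImmersion.lift f.isoLocus.ι (a' ≫ (f.trans h).isoLocus.ι) (by
          rintro _ ⟨t, rfl⟩
          obtain ⟨w, hw, -⟩ := hpt ((a' ≫ (f.trans h).isoLocus.ι) t) ((b' ≫ h.isoLocus.ι) t) (by
            rw [← Hom.comp_apply, e, Hom.comp_apply])
          exact ⟨w, hw⟩)
      have hw : w ≫ f.isoLocus.ι = a' ≫ (f.trans h).isoLocus.ι := IsOpenImmersion.lift_fac _ _ _
      refine (isoLocusHom_trans f h hfd hd hfhd w b' a' ?_ hw).symm
      rw [← cancel_mono j, Category.assoc, ← hij.w, ← Category.assoc, hw, e]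
    · intro u v e
      have h1 := (f.trans h).rel_isoLocusHom u
      rw [e] at h1
      have h2 := h1.trans (h.rel_isoLocusHom v).symm
      rw [trans_assoc, trans_symm, trans_refl] at h2
      obtain ⟨w, hw⟩ := f.isoLocus.exists_ι_eq (mem_isoLocus.2 ⟨_, h2⟩)
      have h3 := f.rel_isoLocusHom w
      rw [hw] at h3
      rw [Hom.comp_apply, Hom.comp_apply, ← hw, h2.functional h3, ← Hom.comp_apply, hij.w,
        Hom.comp_apply]
  have hloc : LocallyOfFiniteType s :=
    have : IsZariskiLocalAtSource @LocallyOfFiniteType :=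
      HasRingHomProperty.instIsZariskiLocalAtSource
    IsZariskiLocalAtSource.of_openImmersions @LocallyOfFiniteType i j hcov s
      (his ▸ inferInstance) (hjs ▸ inferInstance)
  have hnoeth : IsLocallyNoetherian G := LocallyOfFiniteType.isLocallyNoetherian s
  have hsep : IsSeparated s := by
    refine IsSeparated.of_forall_exists s fun x y => ?_
    rcases hcov x with ⟨a, rfl⟩ | ⟨b, rfl⟩ <;> rcases hcov y with ⟨a', rfl⟩ | ⟨b', rfl⟩
    · exact ⟨_, _, _, i, i, A.str, 𝟙 _, 𝟙 _, hi, hi, inferInstance, his ▸ inferInstance, ⟨_, rfl⟩,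
        ⟨_, rfl⟩, by rw [his, Category.id_comp], by rw [his, Category.id_comp],
        fun T a b e => by rw [(cancel_mono i).1 e], fun u v e => congrArg i e⟩
    · obtain ⟨U, V, C, i', j', c, p, q, h1, h2, h3, h4, -, h6, h7, h8, h9, h10, h11⟩ := key a b'
      exact ⟨U, V, C, i', j', c, p, q, h1, h2, h3, h4, h6, h7, h8, h9, h10, h11⟩
    · obtain ⟨U, V, C, i', j', c, p, q, h1, h2, h3, -, h5, h6, h7, h8, h9, h10, h11⟩ := key a' b
      exact ⟨V, U, C, j', i', c, q, p, h2, h1, h3, h5, h7, h6, h9, h8,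
        fun T a b e => (h10 T b a e.symm).symm, fun u v e => (h11 v u e.symm).symm⟩
    · exact ⟨_, _, _, j, j, B.str, 𝟙 _, 𝟙 _, hj, hj, inferInstance, hjs ▸ inferInstance, ⟨_, rfl⟩,
        ⟨_, rfl⟩, by rw [hjs, Category.id_comp], by rw [hjs, Category.id_comp],
        fun T a b e => by rw [(cancel_mono j).1 e], fun u v e => congrArg j e⟩
  have hint : IsIntegral G := by
    obtain ⟨x, hx⟩ := hne
    obtain ⟨w, rfl⟩ := f.isoLocus.exists_ι_eq hx
    refine isIntegral_of_openImmersions i j hcov (a := f.isoLocus.ι w) (b := f.isoLocusHom w) ?_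
    rw [← Hom.comp_apply, hij.w, Hom.comp_apply]
  have hqc : QuasiCompact s := by
    rw [quasiCompact_iff_compactSpace, ← isCompact_univ_iff]
    have : Set.univ = Set.range i ∪ Set.range j := by
      ext g
      simpa using hcov g
    rw [this]
    exact (isCompact_range i.continuous).union (isCompact_range j.continuous)
  let G' : Variety k := { scheme := G, str := s }
  let φ : BirationalMap A G' := ofOpenImmersion (B := G') i his
  let ψ : BirationalMap B G' := ofOpenImmersion (B := G') j hjs
  have hφ : ∀ a, φ.Rel a (i a) := fun a => φ.rel_of_hom_eq i rfl a
  have hψ : ∀ b, ψ.Rel b (j b) := fun b => ψ.rel_of_hom_eq j rfl b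
  refine ⟨G', φ, ψ, fun a => ⟨_, hφ a⟩, fun b => ⟨_, hψ b⟩, fun g => ?_, ext_hom ?_⟩
  · rcases hcov g with ⟨a, rfl⟩ | ⟨b, rfl⟩
    · exact Or.inl ⟨a, hφ a⟩
    · exact Or.inr ⟨b, hψ b⟩
  · change i.toRationalMap = f.hom.comp j.toRationalMap
    rw [RationalMap.comp_toRationalMap, ← f.toRationalMap_isoLocusHom hfd,
      ← RationalMap.compHom_toRationalMap]
    refine PartialMap.toRationalMap_eq_iff.2 ⟨f.isoLocus, hfd, le_top, le_rfl, ?_⟩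
    change A.scheme.homOfLE le_top ≫ A.scheme.topIso.hom ≫ i =
      A.scheme.homOfLE le_rfl ≫ f.isoLocusHom ≫ j
    simp [← hij.w]

end BirationalMap

/-! ### Points of small codimension -/

namespace AlgebraicGeometry.Scheme

theorem coheight_le_of_mem_closure {X : Scheme.{u}} {x y : X} (h : y ∈ closure {x}) :
    Order.coheight x ≤ Order.coheight y :=
  Order.coheight_anti (specializes_iff_mem_closure.2 h)

theorem eq_of_mem_closure {X : Scheme.{u}} {x y : X} {n : ℕ} (h : y ∈ closure {x})
    (hx : Order.coheight x = n) (hy : Order.coheight y ≤ n) : y = x := by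
  by_contra hne
  have hle : y ≤ x := specializes_iff_mem_closure.2 h
  have hlt : y < x := lt_of_le_not_ge hle fun h' =>
    hne (Specializes.antisymm (show y ⤳ x from h') (show x ⤳ y from hle)).eq
  have := Order.coheight_add_one_le hlt
  rw [hx] at this
  exact absurd (this.trans hy) (by exact_mod_cast (Nat.lt_succ_self n).not_ge)

/-- A closed subset of codimension `> n` contains only finitely many points of codimension
`n + 1`. -/
theorem finite_coheight_eq {X : Scheme.{u}} [NoetherianSpace X] {Z : Set X} (hZ : IsClosed Z)
    {n : ℕ} (h : ∀ x ∈ Z, (n : ℕ∞) < Order.coheight x) :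
    {x ∈ Z | Order.coheight x = (n + 1 : ℕ)}.Finite := by
  obtain ⟨S, hS, hcl, hirr, hZS⟩ := NoetherianSpace.exists_finite_set_isClosed_irreducible hZ
  have : Finite S := hS
  refine (Set.finite_range fun T : S => (hirr T T.2).genericPoint).subset ?_
  rintro x ⟨hx, hxn⟩
  rw [hZS] at hx
  obtain ⟨T, hT, hxT⟩ := hx
  refine ⟨⟨T, hT⟩, ?_⟩
  have hc : closure {(hirr T hT).genericPoint} = T :=
    (hirr T hT).genericPoint_closure_eq.trans (hcl T hT).closure_eq
  have hxc : x ∈ closure {(hirr T hT).genericPoint} := by rwa [hc]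
  have hg : (hirr T hT).genericPoint ∈ Z := by
    rw [hZS]
    refine ⟨T, hT, ?_⟩
    have := subset_closure (Set.mem_singleton (hirr T hT).genericPoint)
    rwa [hc] at this
  refine (eq_of_mem_closure hxc (n := n + 1) ?_ hxn.le).symm
  refine le_antisymm (hxn ▸ coheight_le_of_mem_closure hxc) ?_
  exact_mod_cast Order.add_one_le_of_lt (h _ hg)

theorem coheight_genericPoint (X : Scheme.{u}) [IrreducibleSpace X] :
    Order.coheight (genericPoint X) = 0 :=
  Order.coheight_eq_zero.2 fun x _ => genericPoint_specializes x

end AlgebraicGeometry.Scheme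

namespace MarkedPair

open BirationalMap Scheme

variable {k : Type u} [Field k] {l : ℕ} {X : Variety k}

/-- The birational map between two marked varieties that is compatible with the markings. -/
noncomputable def transition (M N : MarkedPair l X) : BirationalMap M.var N.var :=
  M.map.trans N.map.symm

theorem transition_trans (M N P : MarkedPair l X) :
    (M.transition N).trans (N.transition P) = M.transition P := by
  rw [transition, transition, trans_assoc, ← trans_assoc N.map.symm, symm_trans, refl_trans,
    transition]

theorem rel_transition_trans {M N P : MarkedPair l X} {x y z}
    (h : (M.transition N).Rel x y) (h' : (N.transition P).Rel y z) :
    (M.transition P).Rel x z := by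
  rw [← transition_trans M N P]
  exact h.trans h'

theorem rel_transition_symm {M N : MarkedPair l X} {x y} (h : (M.transition N).Rel x y) :
    (N.transition M).Rel y x :=
  h.symm

theorem rel_transition_self_iff {M : MarkedPair l X} {x y} :
    (M.transition M).Rel x y ↔ x = y := by
  have : (M.transition M).Rel x x := by
    rw [transition, trans_symm]
    exact rel_of_hom_eq _ (𝟙 _) rfl x
  exact ⟨fun h => this.functional h, fun h => h ▸ this⟩

theorem exists_rel_of_coheight_le (M N : MarkedPair l X) {x : M.var.scheme}
    (hx : Order.coheight x ≤ l) : ∃ y, (M.transition N).Rel x y := by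
  obtain ⟨y, hy⟩ := ((M.map.isIsoInCodim_iff l).1 M.isIsoInCodim).1 x hx
  obtain ⟨z, hz⟩ := ((N.map.isIsoInCodim_iff l).1 N.isIsoInCodim).2 y (hy.coheight_eq.trans_le hx)
  exact ⟨z, hy.trans hz.symm⟩

/-- The points of codimension `l + 1` of marked varieties, up to the transition maps. -/
instance pointSetoid (l : ℕ) (X : Variety k) :
    Setoid (Σ M : MarkedPair l X, {x : M.var.scheme // Order.coheight x = (l + 1 : ℕ)}) where
  r p q := (p.1.transition q.1).Rel p.2 q.2
  iseqv := ⟨fun _ => rel_transition_self_iff.2 rfl, rel_transition_symm, rel_transition_trans⟩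

/-- The set of all points of codimension `l + 1` of the marked varieties. -/
def PointClass (l : ℕ) (X : Variety k) : Type (u + 1) := Quotient (pointSetoid l X)

/-- The class of a point of codimension `l + 1`. -/
def pointClass (M : MarkedPair l X) (x : M.var.scheme) (hx : Order.coheight x = (l + 1 : ℕ)) :
    PointClass l X :=
  Quotient.mk _ ⟨M, x, hx⟩

theorem pointClass_eq_iff {M N : MarkedPair l X} {x y} {hx : Order.coheight x = (l + 1 : ℕ)}
    {hy : Order.coheight y = (l + 1 : ℕ)} :
    M.pointClass x hx = N.pointClass y hy ↔ (M.transition N).Rel x y :=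
  Quotient.eq

/-- The points of codimension `l + 1` on a marked variety. -/
def points (M : MarkedPair l X) : Set (PointClass l X) :=
  {e | ∃ x hx, M.pointClass x hx = e}

theorem pointClass_mem_points_iff {M N : MarkedPair l X} {x} {hx : Order.coheight x = (l + 1 : ℕ)} :
    M.pointClass x hx ∈ N.points ↔ ∃ y, (M.transition N).Rel x y := by
  constructor
  · rintro ⟨y, hy, h⟩
    exact ⟨y, pointClass_eq_iff.1 h.symm⟩
  · rintro ⟨y, h⟩
    exact ⟨y, h.coheight_eq.trans hx, (pointClass_eq_iff.2 h).symm⟩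

theorem pointClass_mem_points (M : MarkedPair l X) (x) (hx : Order.coheight x = (l + 1 : ℕ)) :
    M.pointClass x hx ∈ M.points :=
  ⟨x, hx, rfl⟩

theorem points_subset_iff {M N : MarkedPair l X} : M.points ⊆ N.points ↔
    ∀ x, Order.coheight x ≤ (l + 1 : ℕ) → ∃ y, (M.transition N).Rel x y := by
  constructor
  · intro h x hx
    rcases hx.eq_or_lt with hx | hx
    · exact pointClass_mem_points_iff.1 (h (M.pointClass_mem_points x hx))
    · refine M.exists_rel_of_coheight_le N ?_
      rw [Nat.cast_add, Nat.cast_one] at hx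
      exact Order.le_of_lt_add_one hx
  · rintro h _ ⟨x, hx, rfl⟩
    exact pointClass_mem_points_iff.2 (h x hx.le)

theorem equivalent_iff {M N : MarkedPair l X} : M.Equivalent N ↔ M.points = N.points := by
  rw [Set.Subset.antisymm_iff, points_subset_iff, points_subset_iff, and_comm]
  refine (isIsoInCodim_iff (N.transition M) (l + 1)).trans (and_congr Iff.rfl ?_)
  exact forall₂_congr fun x _ => exists_congr fun y => rel_symm_iff (f := M.transition N)

theorem finite_points_diff (M N : MarkedPair l X) : (M.points \ N.points).Finite := by
  have h := finite_coheight_eq (M.transition N).isClosed_exc (n := l) (fun x hx => by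
    by_contra hle
    exact ((M.transition N).notMem_exc_iff x).2
      (M.exists_rel_of_coheight_le N (not_lt.1 hle)) hx)
  have : Finite {x ∈ (M.transition N).exc | Order.coheight x = (l + 1 : ℕ)} := h
  refine (Set.finite_range fun x : {x ∈ (M.transition N).exc | Order.coheight x = (l + 1 : ℕ)} =>
    M.pointClass x x.2.2).subset ?_
  rintro _ ⟨⟨x, hx, rfl⟩, hN⟩
  refine ⟨⟨x, ?_, hx⟩, rfl⟩
  by_contra hexc
  exact hN (pointClass_mem_points_iff.2 ((notMem_exc_iff _ x).1 hexc))

/-- The restriction of the marking to an open subset. -/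
noncomputable def restrict (M : MarkedPair l X) (U : M.var.scheme.Opens)
    (hU : (U : Set M.var.scheme).Nonempty) (h : (M.map.restrict U hU).IsIsoInCodim l) :
    MarkedPair l X :=
  ⟨M.var.openSubvariety U hU, M.map.restrict U hU, h⟩

theorem nonempty_of_coheight (M : MarkedPair l X) {U : M.var.scheme.Opens}
    (h : ∀ x, Order.coheight x ≤ l → x ∈ U) : (U : Set M.var.scheme).Nonempty :=
  ⟨genericPoint M.var.scheme, h _ (by rw [coheight_genericPoint]; exact zero_le)⟩

theorem isIsoInCodim_restrict (M : MarkedPair l X) {U : M.var.scheme.Opens}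
    (hU : (U : Set M.var.scheme).Nonempty) (h : ∀ x, Order.coheight x ≤ l → x ∈ U) :
    (M.map.restrict U hU).IsIsoInCodim l := by
  have hM := (M.map.isIsoInCodim_iff l).1 M.isIsoInCodim
  refine (isIsoInCodim_iff _ _).2 ⟨fun p hp => ?_, fun y hy => ?_⟩
  · obtain ⟨y, hy⟩ := hM.1 (U.ι p) ((rel_ofOpen M.var U hU p).coheight_eq.trans_le hp)
    exact ⟨y, (rel_restrict_iff _ _ _ _ _).2 hy⟩
  · obtain ⟨x, hx⟩ := hM.2 y hy
    obtain ⟨p, rfl⟩ := U.exists_ι_eq (h x (hx.coheight_eq.symm.trans_le hy))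
    exact ⟨p, (rel_restrict_iff _ _ _ _ _).2 hx⟩

section restrict

variable {M : MarkedPair l X} {U : M.var.scheme.Opens} {hU : (U : Set M.var.scheme).Nonempty}
  {h : (M.map.restrict U hU).IsIsoInCodim l}

theorem rel_restrict (p : U.toScheme) : ((M.restrict U hU h).transition M).Rel p (U.ι p) := by
  have : (M.restrict U hU h).transition M = ofOpen M.var U hU := by
    rw [transition]
    change ((ofOpen M.var U hU).trans M.map).trans M.map.symm = _
    rw [trans_assoc, trans_symm, trans_refl]
  rw [this]
  exact rel_ofOpen M.var U hU p

theorem pointClass_mem_points_restrict_iff {x} {hx : Order.coheight x = (l + 1 : ℕ)} :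
    M.pointClass x hx ∈ (M.restrict U hU h).points ↔ x ∈ U := by
  rw [pointClass_mem_points_iff]
  constructor
  · rintro ⟨p, hp⟩
    rw [← (rel_restrict p).functional (rel_transition_symm hp)]
    exact U.ι_mem p
  · intro hx
    obtain ⟨p, rfl⟩ := U.exists_ι_eq hx
    exact ⟨p, rel_transition_symm (rel_restrict p)⟩

theorem points_restrict_subset : (M.restrict U hU h).points ⊆ M.points := by
  rintro _ ⟨p, hp, rfl⟩
  exact pointClass_mem_points_iff.2 ⟨_, rel_restrict p⟩

theorem points_restrict_eq_diff {F : Set (PointClass l X)}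
    (hF : ∀ x hx, M.pointClass x hx ∈ F ↔ x ∉ U) :
    (M.restrict U hU h).points = M.points \ F := by
  ext e
  constructor
  · intro he
    obtain ⟨x, hx, rfl⟩ := points_restrict_subset he
    exact ⟨M.pointClass_mem_points x hx,
      fun hxF => (hF x hx).1 hxF (pointClass_mem_points_restrict_iff.1 he)⟩
  · rintro ⟨⟨x, hx, rfl⟩, hxF⟩
    exact pointClass_mem_points_restrict_iff.2 (by_contra fun hn => hxF ((hF x hx).2 hn))

end restrict

/-- Finitely many points of codimension `l + 1` can be removed. -/
theorem exists_points_eq_diff (M : MarkedPair l X) {F : Set (PointClass l X)} (hF : F.Finite) :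
    ∃ N : MarkedPair l X, N.points = M.points \ F := by
  let Z : Set M.var.scheme := {x | ∃ hx, M.pointClass x hx ∈ F}
  have hZ : Z.Finite := by
    have hinj : Function.Injective fun x : Z => (⟨_, x.2.2⟩ : F) := fun x y hxy =>
      Subtype.ext (rel_transition_self_iff.1 (pointClass_eq_iff.1 (congrArg Subtype.val hxy)))
    have : Finite F := hF
    exact Finite.of_injective _ hinj
  let U : M.var.scheme.Opens :=
    ⟨(⋃ x ∈ Z, closure {x})ᶜ, (hZ.isClosed_biUnion fun _ _ => isClosed_closure).isOpen_compl⟩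
  have hmem : ∀ y, y ∈ U ↔ ∀ x ∈ Z, y ∉ closure {x} := fun y => by
    change y ∈ (⋃ x ∈ Z, closure {x})ᶜ ↔ _
    simp
  have hle : ∀ y, Order.coheight y ≤ l → y ∈ U := by
    intro y hy
    rw [hmem]
    rintro x ⟨hx, -⟩ hyx
    have := (coheight_le_of_mem_closure hyx).trans hy
    rw [hx] at this
    exact absurd this (by exact_mod_cast (Nat.lt_succ_self l).not_ge)
  refine ⟨M.restrict U (M.nonempty_of_coheight hle) (M.isIsoInCodim_restrict _ hle),
    points_restrict_eq_diff fun x hx => ?_⟩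
  rw [hmem]
  push Not
  constructor
  · exact fun h => ⟨x, ⟨hx, h⟩, subset_closure rfl⟩
  · rintro ⟨y, ⟨hy, hyF⟩, hxy⟩
    obtain rfl := eq_of_mem_closure hxy hy hx.le
    exact hyF

/-- Marked varieties can be glued if any two points of codimension `l + 1` on their union lie on a
common marked variety. -/
theorem exists_points_eq_union (M : MarkedPair l X) (T : Finset (PointClass l X))
    (h : ∀ a ∈ T, ∀ b ∈ T, ∃ N : MarkedPair l X, N.points = M.points ∪ {a, b}) :
    ∃ N : MarkedPair l X, N.points = M.points ∪ T := by
  classical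
  induction T using Finset.induction_on with
  | empty => exact ⟨M, by simp⟩
  | insert b T hb ih =>
    obtain ⟨A, hA⟩ := ih fun a ha b hb =>
      h a (Finset.mem_insert_of_mem ha) b (Finset.mem_insert_of_mem hb)
    obtain ⟨B, hB⟩ := h b (Finset.mem_insert_self b T) b (Finset.mem_insert_self b T)
    have hC : ∀ a : (insert b T : Finset _),
        ∃ N : MarkedPair l X, N.points = M.points ∪ {a.1, b} :=
      fun a => h a a.2 b (Finset.mem_insert_self b T)
    choose C hC using hC
    let b' : (insert b T : Finset _) := ⟨b, Finset.mem_insert_self b T⟩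
    let U : A.var.scheme.Opens := ⨆ a, (A.transition (C a)).isoLocus
    let V : B.var.scheme.Opens :=
      ⟨⋂ a, (B.transition (C a)).isoLocus, isOpen_iInter_of_finite fun a => Opens.isOpen _⟩
    have hUmem : ∀ x, x ∈ U ↔ ∃ a y, (A.transition (C a)).Rel x y := fun x => by
      simp only [U, Opens.mem_iSup, mem_isoLocus]
    have hVmem : ∀ x, x ∈ V ↔ ∀ a, ∃ y, (B.transition (C a)).Rel x y := fun x => by
      change x ∈ (⋂ a, ((B.transition (C a)).isoLocus : Set B.var.scheme)) ↔ _
      simp only [Set.mem_iInter, SetLike.mem_coe, mem_isoLocus]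
    have hU : ∀ x, Order.coheight x ≤ l → x ∈ U := fun x hx =>
      (hUmem x).2 ⟨b', A.exists_rel_of_coheight_le _ hx⟩
    have hV : ∀ x, Order.coheight x ≤ l → x ∈ V := fun x hx =>
      (hVmem x).2 fun a => B.exists_rel_of_coheight_le _ hx
    let A' := A.restrict U (A.nonempty_of_coheight hU) (A.isIsoInCodim_restrict _ hU)
    let B' := B.restrict V (B.nonempty_of_coheight hV) (B.isIsoInCodim_restrict _ hV)
    have hA' : A'.points = M.points ∪ T := by
      refine hA ▸ Set.Subset.antisymm points_restrict_subset ?_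
      rintro _ ⟨x, hx, rfl⟩
      refine pointClass_mem_points_restrict_iff.2 ((hUmem x).2 ?_)
      simp only [← pointClass_mem_points_iff (hx := hx), hC]
      have hxA := A.pointClass_mem_points x hx
      rw [hA] at hxA
      rcases hxA with hxM | hxT
      · exact ⟨b', Or.inl hxM⟩
      · exact ⟨⟨_, Finset.mem_insert_of_mem hxT⟩, Or.inr (Or.inl rfl)⟩
    have hB' : B'.points = M.points ∪ {b} := by
      rw [Set.pair_eq_singleton] at hB
      refine hB ▸ Set.Subset.antisymm points_restrict_subset ?_
      rintro _ ⟨x, hx, rfl⟩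
      refine pointClass_mem_points_restrict_iff.2 ((hVmem x).2 fun a => ?_)
      rw [← pointClass_mem_points_iff (hx := hx), hC]
      have hxB := B.pointClass_mem_points x hx
      rw [hB] at hxB
      exact hxB.imp id fun h => Or.inr h
    obtain ⟨G, φ, ψ, hφ, hψ, hG, hφψ⟩ := exists_glue (A'.transition B')
      ⟨genericPoint _, mem_isoLocus.2 (A'.exists_rel_of_coheight_le B' (by
        rw [coheight_genericPoint]; exact zero_le))⟩ fun p q => by
      obtain ⟨a, y, hy⟩ := (hUmem _).1 (U.ι_mem p)
      obtain ⟨z, hz⟩ := (hVmem _).1 (V.ι_mem q) a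
      refine ⟨(C a).var, B'.transition (C a), ⟨y, ?_⟩, z, rel_transition_trans (rel_restrict q) hz⟩
      rw [transition_trans]
      exact rel_transition_trans (rel_restrict p) hy
    have hiso : (ψ.symm.trans B'.map).IsIsoInCodim l := by
      have hB := (B'.map.isIsoInCodim_iff l).1 B'.isIsoInCodim
      refine (isIsoInCodim_iff _ _).2 ⟨fun g hg => ?_, fun y hy => ?_⟩
      · obtain ⟨q, hq⟩ : ∃ q, ψ.Rel q g := by
          rcases hG g with ⟨p, hp⟩ | hq
          · obtain ⟨q, hq⟩ := A'.exists_rel_of_coheight_le B' (hp.coheight_eq.symm.trans_le hg)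
            obtain ⟨g', hg'⟩ := hψ q
            rw [hφψ] at hp
            exact ⟨q, hp.functional (hq.trans hg') ▸ hg'⟩
          · exact hq
        obtain ⟨y, hy⟩ := hB.1 q (hq.coheight_eq.symm.trans_le hg)
        exact ⟨y, hq.symm.trans hy⟩
      · obtain ⟨q, hq⟩ := hB.2 y hy
        obtain ⟨g, hg⟩ := hψ q
        exact ⟨g, hg.symm.trans hq⟩
    let N : MarkedPair l X := ⟨G, ψ.symm.trans B'.map, hiso⟩
    have hBN : B'.transition N = ψ := by
      change B'.map.trans (B'.map.symm.trans ψ) = ψ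
      rw [← trans_assoc, trans_symm, refl_trans]
    have hAN : A'.transition N = φ := by
      rw [← transition_trans A' B' N, hBN, hφψ]
    refine ⟨N, ?_⟩
    have hN : N.points = A'.points ∪ B'.points := by
      refine Set.Subset.antisymm ?_ (Set.union_subset ?_ ?_)
      · rintro _ ⟨g, hg, rfl⟩
        rcases hG g with ⟨p, hp⟩ | ⟨q, hq⟩
        · exact Or.inl (pointClass_mem_points_iff.2 ⟨p, rel_transition_symm (hAN ▸ hp)⟩)
        · exact Or.inr (pointClass_mem_points_iff.2 ⟨q, rel_transition_symm (hBN ▸ hq)⟩)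
      · rintro _ ⟨p, hp, rfl⟩
        rw [pointClass_mem_points_iff, hAN]
        exact hφ p
      · rintro _ ⟨q, hq, rfl⟩
        rw [pointClass_mem_points_iff, hBN]
        exact hψ q
    rw [hN, hA', hB', Finset.coe_insert, Set.insert_eq, ← Set.union_union_distrib_left,
      Set.union_comm {b}]

end MarkedPair

/-! ### The model of the complex by sets of points -/

theorem mem_removeAll_iff {T : Type u} [TopologicalSpace T] {n : ℕ}
    {D : Fin n → IrreducibleCloseds T} {s : Set (Fin n)} {y : T} :
    y ∈ removeAll D s ↔ ∀ i ∈ s, y ∉ (D i : Set T) := by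
  change y ∈ (⋃ i ∈ s, (D i : Set T))ᶜ ↔ _
  simp

namespace MarkedVertex

open BirationalMap Scheme MarkedPair

variable {k : Type u} [Field k] {l : ℕ} {X : Variety k}

/-- The points of codimension `l + 1` on a vertex. -/
def points : MarkedVertex l X → Set (PointClass l X) :=
  Quot.lift MarkedPair.points fun _ _ h => equivalent_iff.1 h

theorem points_injective : Function.Injective (points (l := l) (X := X)) := by
  rintro ⟨M⟩ ⟨N⟩ h
  exact Quot.sound (equivalent_iff.2 h)

theorem pointClass_mem_image_iff {M : MarkedPair l X} {n : ℕ} {x : Fin n → M.var.scheme}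
    {hx : ∀ i, Order.coheight (x i) = (l + 1 : ℕ)} {D : Fin n → IrreducibleCloseds M.var.scheme}
    (hD : ∀ i, (D i : Set M.var.scheme) = closure {x i}) (s : Set (Fin n)) (y : M.var.scheme)
    (hy : Order.coheight y = (l + 1 : ℕ)) :
    M.pointClass y hy ∈ (fun i => M.pointClass (x i) (hx i)) '' s ↔ y ∉ removeAll D s := by
  rw [mem_removeAll_iff]
  push Not
  constructor
  · rintro ⟨i, hi, h⟩
    obtain rfl := rel_transition_self_iff.1 (pointClass_eq_iff.1 h)
    exact ⟨i, hi, hD i ▸ subset_closure rfl⟩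
  · rintro ⟨i, hi, h⟩
    rw [hD] at h
    obtain rfl := eq_of_mem_closure h (hx i) hy.le
    exact ⟨i, hi, rfl⟩

theorem isCube_iff {n : ℕ} (c : (Fin n → Bool) → MarkedVertex l X) :
    (birationalCubeComplex l X).IsCube n c ↔
      ∃ b₀ D, CubeFamily.IsSetCube (points (l := l) (X := X)) c b₀ D := by
  constructor
  · rintro ⟨-, b₀, M, D, hM, hinj, hcodim, hD⟩
    let x : Fin n → M.var.scheme := fun i => (D i).isIrreducible.genericPoint
    have hDx : ∀ i, (D i : Set M.var.scheme) = closure {x i} := fun i =>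
      ((D i).isIrreducible.genericPoint_closure_eq.trans (D i).isClosed.closure_eq).symm
    have hx : ∀ i, Order.coheight (x i) = (l + 1 : ℕ) := fun i => by
      rw [← hcodim i, codim_irreducibleCloseds, coheight_irreducibleCloseds _ _ (hDx i)]
    refine ⟨b₀, fun i => M.pointClass (x i) (hx i), fun i j hij => hinj ?_, fun i => ?_,
      fun b => ?_⟩
    · refine IrreducibleCloseds.ext ?_
      rw [hDx, hDx, rel_transition_self_iff.1 (pointClass_eq_iff.1 hij)]
    · rw [hM]
      exact M.pointClass_mem_points _ _
    · obtain ⟨hU, h, hb⟩ := hD b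
      rw [hb, hM]
      exact points_restrict_eq_diff (h := h) (pointClass_mem_image_iff hDx _)
  · rintro ⟨b₀, D, h⟩
    obtain ⟨M, hM⟩ := Quot.exists_rep (c b₀)
    have hDM : ∀ i, D i ∈ M.points := fun i => by
      have := h.mem i
      rwa [← hM] at this
    choose x hx hxD using hDM
    obtain rfl : (fun i => M.pointClass (x i) (hx i)) = D := funext hxD
    let Z : Fin n → IrreducibleCloseds M.var.scheme := fun i =>
      ⟨closure {x i}, isIrreducible_singleton.closure, isClosed_closure⟩
    have hZ : ∀ i, (Z i : Set M.var.scheme) = closure {x i} := fun _ => rfl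
    refine ⟨h.corner_injective, b₀, M, Z, hM.symm, fun i j hij => h.injective ?_,
      fun i => ?_, fun b => ?_⟩
    · refine pointClass_eq_iff.2 (rel_transition_self_iff.2 ?_)
      have h1 : x i ∈ closure {x j} := by
        rw [← hZ, ← hij]
        exact subset_closure rfl
      exact eq_of_mem_closure h1 (hx j) (hx i).le
    · rw [codim_irreducibleCloseds, coheight_irreducibleCloseds _ _ (hZ i), hx]
    · have hle : ∀ y, Order.coheight y ≤ l →
          y ∈ removeAll Z {i | b i ≠ b₀ i} := by
        intro y hy
        rw [mem_removeAll_iff]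
        intro i _ hyi
        have := (coheight_le_of_mem_closure hyi).trans hy
        rw [hx] at this
        exact absurd this (by exact_mod_cast (Nat.lt_succ_self l).not_ge)
      refine ⟨M.nonempty_of_coheight hle, M.isIsoInCodim_restrict _ hle, points_injective ?_⟩
      rw [h.eq b, ← hM]
      exact (points_restrict_eq_diff (pointClass_mem_image_iff hZ _)).symm

theorem isSetModel (l : ℕ) (X : Variety k) :
    (birationalCubeComplex l X).IsSetModel (points (l := l) (X := X)) where
  injective := points_injective
  finite_diff := by
    rintro ⟨M⟩ ⟨N⟩
    exact M.finite_points_diff N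
  exists_diff := by
    rintro ⟨M⟩ F hF
    obtain ⟨N, hN⟩ := M.exists_points_eq_diff hF
    exact ⟨Quot.mk _ N, hN⟩
  exists_union := by
    rintro ⟨M⟩ T h
    obtain ⟨N, hN⟩ := M.exists_points_eq_union T fun a ha b hb => by
      obtain ⟨⟨N⟩, hN⟩ := h a ha b hb
      exact ⟨N, hN⟩
    exact ⟨Quot.mk _ N, hN⟩
  isCube_iff := isCube_iff

instance : Nonempty (MarkedVertex l X) :=
  ⟨Quot.mk _ ⟨X, refl X, (isIsoInCodim_iff _ _).2
    ⟨fun x _ => ⟨x, rel_of_hom_eq _ (𝟙 _) rfl x⟩, fun x _ => ⟨x, rel_of_hom_eq _ (𝟙 _) rfl x⟩⟩⟩⟩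

end MarkedVertex

theorem theorem1p2 {k : Type u} [Field k] (X : Variety k) (d : ℕ)
    (hd : topologicalKrullDim X.scheme = d) (l : ℕ) (hl : l < d) :
    (birationalCubeComplex l X).IsCAT0CubeComplex :=
  (MarkedVertex.isSetModel l X).isCAT0CubeComplex
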